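/- Let $n\ge 1$. Polytopes are taken up to combinatorial equivalence (isomorphism of face lattices): an $n$-cube (resp. $n$-crosspolytope) is a polytope in $\mathbb{R}^n$ combinatorially equivalent to $[0,1]^n$ (resp. to $\operatorname{conv}\{\pm e_1,\dots,\pm e_n\}$). Definitions. A shelling of a $d$-polytope $P$ ($d\ge 1$) is an ordering $F_1,\dots,F_m$ of all its facets such that either $d=1$, or $F_1$ has a shelling and, for each $j>1$, $F_j\cap(F_1\cup\dots\cup F_{j-1})=G_1\cup\dots\cup G_r$ for some shelling $G_1,\dots,G_k$ of the polytope $F_j$ and some $1\le r\le k$. Let $P\subset\mathbb{R}^n$ be a full-dimensional polytope, $x$ an interior point of $P$ and $u\in\mathbb{R}^n$ a direction such that the line $x+\mathbb{R}u$ is parallel to no facet hyperplane and meets the facet hyperplanes in distinct points. The line shelling of $P$ along the oriented line $x+\mathbb{R}u$ is the order in which its facet hyperplanes are passed when one travels on the line from $x$ in direction $u$ to infinity and returns from the opposite end to $x$. An ordering of the facets of an $n$-polytope $P\subset\mathbb{R}^n$ is called a line shelling if some polytope $Q\subset\mathbb{R}^n$ and some isomorphism of the face lattice of $P$ onto that of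 $Q$ carry it to the line shelling of $Q$ along some oriented line. Likewise an ordering of the vertices of $C$ is induced by a linear functional if some polytope $C'\subset\mathbb{R}^n$ and some isomorphism of face lattices carry it to an ordering $v'_1,\dots,v'_m$ with $f(v'_1)<\dots<f(v'_m)$ for some linear functional $f$ on $\mathbb{R}^n$. Two vertices of a crosspolytope are antipodal if no proper face contains both; the pair sequence of an ordering $v_1,\dots,v_{2n}$ of its vertices is the list of the pairs $\{i,j\}$ with $v_i,v_j$ antipodal, in ascending order of the smaller element, and it is good if for no $0<k<n$ do its first $k$ pairs comprise exactly the set $\{1,\dots,2k\}$. Theorem. (1) Let $P$ be an $n$-cube. An ordering $F_1,\dots,F_{2n}$ of its facets is a shelling if and only if it is a line shelling. (2) Let $P$ be an $n$-cube, $C$ an $n$-crosspolytope, and $\Phi$ an inclusion-reversing bijection from the faces of $C$ to the faces of $P$ (with inclusion-reversing inverse). Let $v_1,\dots,v_{2n}$ be an ordering of the vertices of $C$ and $F_i=\Phi(\{v_i\})$ the corresponding ordering of the facets of $P$. Then $F_1,\dots,F_{2n}$ is a shelling if and only if the pair sequence of $v_1,\dots,v_{2n}$ is good; and $F_1,\dots,F_{2n}$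 is a line shelling if and only if $v_1,\dots,v_{2n}$ is induced by a linear functional. (3) Let $P\subset\mathbb{R}^n$ be any polytope with $0$ in its interior, and let $P^\Delta=\{y:\langle x,y\rangle\le 1\text{ for all }x\in P\}$ be its polar. Then $v\mapsto F_v=\{y\in P^\Delta:\langle v,y\rangle=1\}$ is a bijection from the vertices of $P$ to the facets of $P^\Delta$. Moreover, for every $f\in\mathbb{R}^n$ and every ordering $v_1,\dots,v_m$ of the vertices of $P$, the following are equivalent: (a) $\langle f,v_1\rangle<\dots<\langle f,v_m\rangle$ and all these numbers are nonzero; (b) $F_{v_1},\dots,F_{v_m}$ is the line shelling of $P^\Delta$ along the line $\mathbb{R}f$, started at $0$ in direction $-f$. -/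

import Mathlib

namespace CubeShelling

/-- Real `n`-space with its Euclidean structure. -/
abbrev Euc (n : ℕ) : Type := EuclideanSpace ℝ (Fin n)

section Polytopes

variable {n : ℕ}

/-- A polytope is the convex hull of a finite set of points. -/
def IsPolytope (P : Set (Euc n)) : Prop :=
  ∃ s : Set (Euc n), s.Finite ∧ convexHull ℝ s = P

/-- The faces of `P` (the sets of maximizers of linear functionals on `P`, together with the
empty set), ordered by inclusion. For a polytope this is the face lattice; it contains `∅` and
`P` itself. -/
abbrev Face (P : Set (Euc n)) : Type := {F : Set (Euc n) // IsExposed ℝ P F}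

/-- Two polytopes are combinatorially equivalent if their face lattices are isomorphic. -/
def CombEquiv (P Q : Set (Euc n)) : Prop := Nonempty (Face P ≃o Face Q)

/-- The facets of `P`: its maximal proper faces. -/
def facets (P : Set (Euc n)) : Set (Set (Euc n)) :=
  {F | Maximal (fun G : Set (Euc n) => IsExposed ℝ P G ∧ G ≠ P) F}

/-- The vertices of `P`: the points `v` such that `{v}` is a face. -/
def vertices (P : Set (Euc n)) : Set (Euc n) := {v | IsExposed ℝ P {v}}

/-- `F 0, F 1, …` lists every facet of `P` exactly once. -/
def IsFacetOrdering (P : Set (Euc n)) {m : ℕ} (F : Fin m → Set (Euc n)) : Prop :=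
  Function.Injective F ∧ Set.range F = facets P

/-- `v 0, v 1, …` lists every vertex of `P` exactly once. -/
def IsVertexOrdering (P : Set (Euc n)) {m : ℕ} (v : Fin m → Euc n) : Prop :=
  Function.Injective v ∧ Set.range v = vertices P

/-- The standard `n`-cube `[0,1]ⁿ`. -/
def stdCube (n : ℕ) : Set (Euc n) := {x | ∀ i, 0 ≤ x i ∧ x i ≤ 1}

/-- The standard `n`-crosspolytope, the convex hull of the points `±eᵢ`. -/
def stdCrosspolytope (n : ℕ) : Set (Euc n) :=
  convexHull ℝ {x | ∃ i, x = EuclideanSpace.single i (1 : ℝ) ∨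
    x = -EuclideanSpace.single i (1 : ℝ)}

/-- An `n`-cube (a realization in `ℝⁿ` of the combinatorial `n`-cube). -/
def IsCube (P : Set (Euc n)) : Prop := IsPolytope P ∧ CombEquiv P (stdCube n)

/-- An `n`-crosspolytope (a realization in `ℝⁿ` of the combinatorial `n`-crosspolytope). -/
def IsCrosspolytope (C : Set (Euc n)) : Prop := IsPolytope C ∧ CombEquiv C (stdCrosspolytope n)

/-- `IsShelling d P m F`: the sequence `F 0, …, F (m - 1)` is a shelling of (the boundary complex
of) the `d`-dimensional polytope `P`, where `d ≥ 1`. If `d = 1` the boundary complex has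
dimension `0` and every ordering of the facets is a shelling. If `d ≥ 2`, the first facet must be
shellable, and each later facet `F j` must meet the union of the preceding ones
in `G 0 ∪ … ∪ G (r - 1)` for some shelling `G 0, …, G (k - 1)` of `F j` and some `1 ≤ r ≤ k`. -/
def IsShelling : ℕ → (P : Set (Euc n)) → (m : ℕ) → (F : Fin m → Set (Euc n)) → Prop
  | 0, P, _, F => IsFacetOrdering P F
  | 1, P, _, F => IsFacetOrdering P F
  | d + 2, P, m, F =>
      IsFacetOrdering P F ∧
      (∀ j : Fin m, j.val = 0 →
        ∃ (k : ℕ) (G : Fin k → Set (Euc n)), IsShelling (d + 1) (F j) k G) ∧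
      (∀ j : Fin m, 0 < j.val →
        ∃ (k : ℕ) (G : Fin k → Set (Euc n)), IsShelling (d + 1) (F j) k G ∧
          ∃ r : ℕ, 1 ≤ r ∧ r ≤ k ∧
            F j ∩ (⋃ (i : Fin m) (_ : i < j), F i) = ⋃ (i : Fin k) (_ : i.val < r), G i)

/-- On an oriented line parametrized by `ℝ`, travelling from `0` towards `+∞`, through infinity,
and back from `-∞` to `0`, the parameter `s` is passed before the parameter `t`. -/
def PassedBefore (s t : ℝ) : Prop :=
  (0 < s ∧ s < t) ∨ (0 < s ∧ t < 0) ∨ (s < t ∧ t < 0)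

/-- `F 0, F 1, …` is the line shelling of the full-dimensional polytope `P` given by the oriented
line `{x + t u}` through the interior point `x`: the line meets the hyperplane spanned by each
facet (in the point with parameter `t i`), and, starting at `x`, it passes these hyperplanes
one after the other in the listed order. -/
def IsLineShellingAlong (P : Set (Euc n)) (x u : Euc n) {m : ℕ} (F : Fin m → Set (Euc n)) : Prop :=
  x ∈ interior P ∧ IsFacetOrdering P F ∧
    ∃ t : Fin m → ℝ, (∀ i, x + t i • u ∈ affineSpan ℝ (F i)) ∧
      ∀ i j, i < j → PassedBefore (t i) (t j)

/-- The ordering `F` of facets of `P`, where `P` stands for its combinatorial type, is a line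
shelling: on some realization `Q` the corresponding ordering of the facets is the line shelling
given by some oriented line. -/
def IsLineShelling (P : Set (Euc n)) {m : ℕ} (F : Fin m → Set (Euc n)) : Prop :=
  ∃ (Q : Set (Euc n)) (φ : Face P ≃o Face Q) (F' : Fin m → Set (Euc n)) (x u : Euc n),
    IsPolytope Q ∧
    (∀ i, ∃ h : IsExposed ℝ P (F i), (φ ⟨F i, h⟩ : Set (Euc n)) = F' i) ∧
    IsLineShellingAlong Q x u F'

/-- The ordering `v` of vertices of `C`, where `C` stands for its combinatorial type, is induced
by a linear functional: on some realization `C'` some linear functional is strictly increasing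
along the corresponding ordering of the vertices. -/
def IsLPOrdering (C : Set (Euc n)) {m : ℕ} (v : Fin m → Euc n) : Prop :=
  ∃ (C' : Set (Euc n)) (ψ : Face C ≃o Face C') (v' : Fin m → Euc n) (f : Euc n →ₗ[ℝ] ℝ),
    IsPolytope C' ∧
    (∀ i, ∃ h : IsExposed ℝ C {v i}, (ψ ⟨{v i}, h⟩ : Set (Euc n)) = {v' i}) ∧
    ∀ i j, i < j → f (v' i) < f (v' j)

/-- Two vertices form one of the pairs of a crosspolytope `C`: no proper face contains both. -/
def IsAntipodal (C : Set (Euc n)) (a b : Euc n) : Prop :=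
  ∀ G : Set (Euc n), IsExposed ℝ C G → a ∈ G → b ∈ G → G = C

open Classical in
/-- The pair sequence of an ordering of the vertices of a crosspolytope: the pairs of labels of
antipodal vertices, the smaller label first, listed in ascending order of the smaller label
(a product of lists is ordered lexicographically). The vertex listed as `v i` has the label
`i`, so that labels start at `0`. -/
noncomputable def pairSequence (C : Set (Euc n)) {m : ℕ} (v : Fin m → Euc n) :
    List (Fin m × Fin m) :=
  (List.finRange m ×ˢ List.finRange m).filter
    (fun p => p.1 < p.2 ∧ IsAntipodal C (v p.1) (v p.2))

/-- The polar `{y | ⟪x, y⟫ ≤ 1 for all x ∈ P}`. -/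
def polarBody (P : Set (Euc n)) : Set (Euc n) := {y | ∀ x ∈ P, inner ℝ x y ≤ 1}

/-- The face of the polar of `P` that is dual to the vertex `v` of `P`. -/
def dualFacet (P : Set (Euc n)) (v : Euc n) : Set (Euc n) :=
  {y | y ∈ polarBody P ∧ inner ℝ v y = 1}

end Polytopes

/-- A sequence of `d` pairs of labels is good if for no `0 < k < d` its first `k` pairs comprise
exactly the `2 k` smallest labels. -/
def IsGoodPairSequence (d : ℕ) {m : ℕ} (S : List (Fin m × Fin m)) : Prop :=
  ∀ k : ℕ, 0 < k → k < d →
    {l : Fin m | ∃ p ∈ S.take k, l = p.1 ∨ l = p.2} ≠ {l : Fin m | l.val < 2 * k}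

end CubeShelling

open CubeShelling

namespace CubeShelling

section Faces

variable {n : ℕ}

theorem IsPolytope.convex {P : Set (Euc n)} (hP : IsPolytope P) : Convex ℝ P := by
  obtain ⟨s, -, rfl⟩ := hP
  exact convex_convexHull ℝ s

theorem IsPolytope.isCompact {P : Set (Euc n)} (hP : IsPolytope P) : IsCompact P := by
  obtain ⟨s, hs, rfl⟩ := hP
  exact hs.isCompact_convexHull ℝ

theorem isExposed_of_forall_le {P : Set (Euc n)} {l : StrongDual ℝ (Euc n)} {c : ℝ}
    (h : ∀ x ∈ P, l x ≤ c) : IsExposed ℝ P {x ∈ P | l x = c} := by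
  rintro ⟨y, hy, hyc⟩
  refine ⟨l, Set.ext fun x => and_congr_right fun hx => ⟨fun hxc z hz => ?_, fun hxm => ?_⟩⟩
  · rw [hxc]; exact h z hz
  · exact le_antisymm (h x hx) (hyc ▸ hxm y hy)

theorem exists_functional_of_isExposed {P F : Set (Euc n)} (hF : IsExposed ℝ P F)
    (hne : F.Nonempty) :
    ∃ (l : StrongDual ℝ (Euc n)) (c : ℝ), (∀ x ∈ P, l x ≤ c) ∧ F = {x ∈ P | l x = c} := by
  obtain ⟨l, hl⟩ := hF hne
  obtain ⟨y, hy⟩ := hne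
  rw [hl] at hy
  refine ⟨l, l y, hy.2, hl.trans (Set.ext fun x => and_congr_right fun hx => ⟨fun h => ?_, fun h => ?_⟩)⟩
  · exact le_antisymm (hy.2 x hx) (h y hy.1)
  · rw [h]; exact hy.2

theorem convexHull_inter_face {s F : Set (Euc n)} (hs : s.Finite)
    (hF : IsExposed ℝ (convexHull ℝ s) F) : convexHull ℝ (s ∩ F) = F := by
  have hconv : Convex ℝ F := hF.convex (convex_convexHull ℝ s)
  refine (convexHull_min Set.inter_subset_right hconv).antisymm ?_
  have hcomp : IsCompact F := hF.isCompact (hs.isCompact_convexHull ℝ)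
  have hfin : (s ∩ F).Finite := hs.subset Set.inter_subset_left
  conv_lhs => rw [← closure_convexHull_extremePoints hcomp hconv]
  refine closure_minimal (convexHull_mono fun x hx => ?_) (hfin.isCompact_convexHull ℝ).isClosed
  exact ⟨extremePoints_convexHull_subset
    (hF.isExtreme.extremePoints_subset_extremePoints hx), hx.1⟩

theorem IsPolytope.face {P F : Set (Euc n)} (hP : IsPolytope P) (hF : IsExposed ℝ P F) :
    IsPolytope F := by
  obtain ⟨s, hs, rfl⟩ := hP
  exact ⟨s ∩ F, hs.subset Set.inter_subset_left, convexHull_inter_face hs hF⟩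

/-- Every nonempty face has a point that lies in no smaller face. -/
theorem IsPolytope.exists_mem_forall_face {P F : Set (Euc n)} (hP : IsPolytope P)
    (hF : IsExposed ℝ P F) (hne : F.Nonempty) :
    ∃ x ∈ F, ∀ G, IsExposed ℝ P G → x ∈ G → F ⊆ G := by
  obtain ⟨s, hs, rfl⟩ := hP
  have hFe := convexHull_inter_face hs hF
  have hfin : (s ∩ F).Finite := hs.subset Set.inter_subset_left
  have hne' : (s ∩ F).Nonempty := by
    rw [← hFe] at hne
    exact convexHull_nonempty_iff.1 hne
  set t := hfin.toFinset with ht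
  have htne : t.Nonempty := hfin.toFinset_nonempty.2 hne'
  have hcard : (0 : ℝ) < t.card := by exact_mod_cast htne.card_pos
  refine ⟨t.centerMass (fun _ => (1 : ℝ)) id, ?_, fun G hG hxG => ?_⟩
  · rw [← hFe]
    refine t.centerMass_mem_convexHull (fun _ _ => zero_le_one) (by simpa using hcard) ?_
    intro i hi
    exact hfin.mem_toFinset.1 hi
  · obtain ⟨l, c, hle, rfl⟩ := exists_functional_of_isExposed hG ⟨_, hxG⟩
    have h1 : ∑ y ∈ t, (c - l y) = 0 := by
      have := hxG.2
      rw [Finset.centerMass, map_smul, map_sum, smul_eq_mul] at this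
      simp only [Finset.sum_const, nsmul_eq_mul, mul_one, id, one_smul] at this
      rw [Finset.sum_sub_distrib, Finset.sum_const, nsmul_eq_mul, ← this]
      field_simp
      ring
    have h2 := (Finset.sum_eq_zero_iff_of_nonneg (fun y hy => sub_nonneg.2
      (hle y (subset_convexHull ℝ s (hfin.mem_toFinset.1 hy).1)))).1 h1
    rw [← hFe]
    refine convexHull_min (fun y hy => ⟨subset_convexHull ℝ s hy.1, ?_⟩)
      (hG.convex (convex_convexHull ℝ s))
    exact (sub_eq_zero.1 (h2 y (hfin.mem_toFinset.2 hy))).symm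

theorem IsPolytope.face_of_face {P F G : Set (Euc n)} (hP : IsPolytope P)
    (hF : IsExposed ℝ P F) (hG : IsExposed ℝ F G) : IsExposed ℝ P G := by
  rcases G.eq_empty_or_nonempty with rfl | hGne
  · exact isExposed_empty
  have hFne : F.Nonempty := hGne.mono hG.subset
  obtain ⟨s, hs, rfl⟩ := hP
  obtain ⟨l₁, c₁, h₁, hFe⟩ := exists_functional_of_isExposed hF hFne
  obtain ⟨l₂, c₂, h₂, hGe⟩ := exists_functional_of_isExposed hG hGne
  have hsP := subset_convexHull ℝ s
  obtain ⟨N, hN⟩ : ∃ N : ℝ, ∀ v ∈ s, (l₂ v - c₂) / (c₁ - l₁ v) < N := by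
    obtain ⟨B, hB⟩ := (hs.image fun v => (l₂ v - c₂) / (c₁ - l₁ v)).bddAbove
    exact ⟨B + 1, fun v hv => (hB ⟨v, hv, rfl⟩).trans_lt (lt_add_one B)⟩
  set l : StrongDual ℝ (Euc n) := N • l₁ + l₂ with hl
  have hlx : ∀ x, l x = N * l₁ x + l₂ x := fun x => by simp [hl]
  have hlt : ∀ v ∈ s, l₁ v < c₁ → l v < N * c₁ + c₂ := by
    intro v hv hlt
    have := (div_lt_iff₀ (sub_pos.2 hlt)).1 (hN v hv)
    rw [hlx]; linarith
  have heq : ∀ v ∈ F, l v = N * c₁ + l₂ v := by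
    intro v hv
    rw [hFe] at hv
    rw [hlx, hv.2]
  have hle : ∀ x ∈ convexHull ℝ s, l x ≤ N * c₁ + c₂ := by
    intro x hx
    have hcv : Convex ℝ {x | l x ≤ N * c₁ + c₂} := convex_halfSpace_le l.isLinear _
    refine convexHull_min (fun v hv => ?_) hcv hx
    rcases (h₁ v (hsP hv)).lt_or_eq with h | h
    · exact (hlt v hv h).le
    · have hvF : v ∈ F := by rw [hFe]; exact ⟨hsP hv, h⟩
      have := h₂ v hvF
      rw [Set.mem_ofPred_eq, heq v hvF]; linarith
  have hG' := isExposed_of_forall_le hle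
  convert hG' using 1
  apply Set.Subset.antisymm
  · intro x hx
    have hxF := hG.subset hx
    rw [hGe] at hx
    exact ⟨hF.subset hxF, by rw [heq x hxF, hx.2]⟩
  · rw [← convexHull_inter_face hs hG']
    refine convexHull_min (fun v hv => ?_) (hG.convex (hF.convex (convex_convexHull ℝ s)))
    have h1 : l₁ v = c₁ := by
      by_contra h
      exact (hlt v hv.1 (lt_of_le_of_ne (h₁ v (hsP hv.1)) h)).ne hv.2.2
    have hvF : v ∈ F := by rw [hFe]; exact ⟨hsP hv.1, h1⟩
    rw [hGe]
    refine ⟨hvF, ?_⟩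
    have := hv.2.2
    rw [heq v hvF] at this
    linarith

theorem vertices_subset_of_convexHull {s : Set (Euc n)} : vertices (convexHull ℝ s) ⊆ s := by
  intro v hv
  have : v ∈ (convexHull ℝ s).extremePoints ℝ :=
    exposedPoints_subset_extremePoints (mem_exposedPoints_iff_exposed_singleton.2 hv)
  exact extremePoints_convexHull_subset this

theorem IsPolytope.finite_vertices {P : Set (Euc n)} (hP : IsPolytope P) :
    (vertices P).Finite := by
  obtain ⟨s, hs, rfl⟩ := hP
  exact hs.subset vertices_subset_of_convexHull

theorem mem_of_mem_vertices {P : Set (Euc n)} {v : Euc n} (hv : v ∈ vertices P) : v ∈ P :=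
  IsExposed.subset hv rfl

theorem extremePoints_subset_vertices {P : Set (Euc n)} (hP : IsPolytope P) :
    P.extremePoints ℝ ⊆ vertices P := by
  intro v hv
  obtain ⟨s, hs, rfl⟩ := hP
  have hcv := convex_convexHull ℝ s
  have hvs := extremePoints_convexHull_subset hv
  have hv' := (hcv.mem_extremePoints_iff_convex_sdiff.1 hv).2
  have hnot : v ∉ convexHull ℝ (s \ {v}) := fun h =>
    (convexHull_min (Set.sdiff_subset_sdiff_left (subset_convexHull ℝ s)) hv' h).2 rfl
  have hfin : (s \ {v}).Finite := hs.subset Set.sdiff_subset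
  obtain ⟨l, u, hlu, huv⟩ := geometric_hahn_banach_closed_point (convex_convexHull ℝ (s \ {v}))
    (hfin.isCompact_convexHull ℝ).isClosed hnot
  have hlt : ∀ w ∈ s, w ≠ v → l w < l v := fun w hw hwv =>
    (hlu w (subset_convexHull ℝ _ ⟨hw, hwv⟩)).trans huv
  have hle : ∀ x ∈ convexHull ℝ s, l x ≤ l v := by
    intro x hx
    refine convexHull_min (t := {x | l x ≤ l v}) (fun w hw => ?_) (convex_halfSpace_le l.isLinear _) hx
    rcases eq_or_ne w v with rfl | h
    · exact le_refl (l w)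
    · exact (hlt w hw h).le
  have hE := isExposed_of_forall_le hle
  change IsExposed ℝ _ {v}
  convert hE using 1
  rw [← convexHull_inter_face hs hE]
  have : s ∩ {x ∈ convexHull ℝ s | l x = l v} = {v} := by
    ext w
    constructor
    · rintro ⟨hw, -, hwv⟩
      by_contra h
      exact (hlt w hw h).ne hwv
    · rintro rfl
      exact ⟨hvs, subset_convexHull ℝ s hvs, rfl⟩
  rw [this, convexHull_singleton]

theorem IsPolytope.convexHull_vertices {P : Set (Euc n)} (hP : IsPolytope P) :
    convexHull ℝ (vertices P) = P := by
  refine (convexHull_min (fun v hv => mem_of_mem_vertices hv) hP.convex).antisymm ?_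
  conv_lhs => rw [← closure_convexHull_extremePoints hP.isCompact hP.convex]
  exact closure_minimal (convexHull_mono (extremePoints_subset_vertices hP))
    (hP.finite_vertices.isCompact_convexHull ℝ).isClosed

theorem IsPolytope.convexHull_vertices_inter {P F : Set (Euc n)} (hP : IsPolytope P)
    (hF : IsExposed ℝ P F) : convexHull ℝ (vertices P ∩ F) = F :=
  convexHull_inter_face hP.finite_vertices (by rwa [hP.convexHull_vertices])

theorem IsPolytope.exists_vertex_mem {P F : Set (Euc n)} (hP : IsPolytope P)
    (hF : IsExposed ℝ P F) (hne : F.Nonempty) : ∃ v ∈ vertices P, v ∈ F := by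
  rw [← hP.convexHull_vertices_inter hF] at hne
  exact convexHull_nonempty_iff.1 hne

instance (P : Set (Euc n)) : BoundedOrder (Face P) where
  top := ⟨P, IsExposed.refl P⟩
  le_top F := F.2.subset
  bot := ⟨∅, isExposed_empty⟩
  bot_le F := Set.empty_subset F.1

theorem isCoatom_iff_mem_facets {P : Set (Euc n)} (F : Face P) :
    IsCoatom F ↔ (F : Set (Euc n)) ∈ facets P := by
  constructor
  · rintro ⟨h1, h2⟩
    refine ⟨⟨F.2, fun h => h1 (Subtype.ext h)⟩, fun G hG hFG => ?_⟩
    by_contra hlt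
    exact hG.2 (congrArg Subtype.val (h2 ⟨G, hG.1⟩ ⟨hFG, hlt⟩))
  · rintro ⟨⟨_, h1⟩, h2⟩
    refine ⟨fun h => h1 (congrArg Subtype.val h), fun G hG => ?_⟩
    by_contra hne
    exact hG.not_ge (h2 ⟨G.2, fun h => hne (Subtype.ext h)⟩ hG.le)

theorem isAtom_singleton {P : Set (Euc n)} {v : Euc n} (hv : IsExposed ℝ P {v}) :
    IsAtom (⟨{v}, hv⟩ : Face P) := by
  refine ⟨fun h => Set.singleton_ne_empty v (congrArg Subtype.val h), fun G hG => ?_⟩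
  refine Subtype.ext ?_
  have h1 : (G : Set (Euc n)) ⊂ {v} := hG
  exact Set.ssubset_singleton_iff.1 h1

theorem IsPolytope.isAtom_iff {P : Set (Euc n)} (hP : IsPolytope P) (F : Face P) :
    IsAtom F ↔ ∃ v ∈ vertices P, (F : Set (Euc n)) = {v} := by
  constructor
  · intro hF
    have hne : (F : Set (Euc n)).Nonempty :=
      Set.nonempty_iff_ne_empty.2 fun h => hF.1 (Subtype.ext h)
    obtain ⟨v, hv, hvF⟩ := hP.exists_vertex_mem F.2 hne
    refine ⟨v, hv, ?_⟩
    have hle : (⟨{v}, hv⟩ : Face P) ≤ F := Set.singleton_subset_iff.2 hvF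
    rcases hle.eq_or_lt with h | h
    · exact (congrArg Subtype.val h).symm
    · exact absurd (congrArg Subtype.val (hF.2 _ h)) (Set.singleton_ne_empty v)
  · rintro ⟨v, hv, h⟩
    obtain rfl : F = ⟨{v}, hv⟩ := Subtype.ext h
    exact isAtom_singleton hv

theorem isExposed_image_affineEquiv (e : Euc n ≃ᵃ[ℝ] Euc n) {P F : Set (Euc n)}
    (hF : IsExposed ℝ P F) : IsExposed ℝ (e '' P) (e '' F) := by
  intro hne
  obtain ⟨l, c, hle, rfl⟩ := exists_functional_of_isExposed hF (Set.image_nonempty.1 hne)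
  set l' : StrongDual ℝ (Euc n) :=
    LinearMap.toContinuousLinearMap (l.toLinearMap ∘ₗ e.symm.linear.toLinearMap) with hl'
  have key : ∀ x y, l' (e x) - l' (e y) = l x - l y := by
    intro x y
    rw [← map_sub l, ← map_sub l']
    have h1 : e.linear (x - y) = e x - e y := e.toAffineMap.linearMap_vsub x y
    rw [← h1]
    simp [hl']
  obtain ⟨_, y, ⟨hy, hyc⟩, -⟩ := hne
  have hE : IsExposed ℝ (e '' P) {x ∈ e '' P | l' x = l' (e y)} := by
    refine isExposed_of_forall_le ?_
    rintro _ ⟨x, hx, rfl⟩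
    have := key x y
    have := hle x hx
    linarith
  have : e '' {x ∈ P | l x = c} = {x ∈ e '' P | l' x = l' (e y)} := by
    ext z
    constructor
    · rintro ⟨x, ⟨hx, hxc⟩, rfl⟩
      refine ⟨⟨x, hx, rfl⟩, ?_⟩
      have := key x y
      linarith
    · rintro ⟨⟨x, hx, rfl⟩, hxy⟩
      refine ⟨x, ⟨hx, ?_⟩, rfl⟩
      have := key x y
      linarith
  rw [this] at *
  exact hE ⟨_, ⟨⟨y, hy, rfl⟩, rfl⟩⟩

/-- Affine equivalences induce isomorphisms of face lattices. -/
noncomputable def faceImage (e : Euc n ≃ᵃ[ℝ] Euc n) (P : Set (Euc n)) : Face P ≃o Face (e '' P) where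
  toFun F := ⟨e '' F.1, isExposed_image_affineEquiv e F.2⟩
  invFun G := ⟨e.symm '' G.1, by
    have := isExposed_image_affineEquiv e.symm G.2
    rwa [← Set.image_comp, show (e.symm ∘ e : Euc n → Euc n) = id from funext fun x =>
      e.symm_apply_apply x, Set.image_id] at this⟩
  left_inv F := Subtype.ext (by
    change e.symm '' (e '' F.1) = F.1
    rw [← Set.image_comp, show (e.symm ∘ e : Euc n → Euc n) = id from funext fun x =>
      e.symm_apply_apply x, Set.image_id])
  right_inv F := Subtype.ext (by
    change e '' (e.symm '' F.1) = F.1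
    rw [← Set.image_comp, show (e ∘ e.symm : Euc n → Euc n) = id from funext fun x =>
      e.apply_symm_apply x, Set.image_id])
  map_rel_iff' {F G} := Set.image_subset_image_iff e.injective

theorem IsPolytope.image_affineEquiv {P : Set (Euc n)} (hP : IsPolytope P)
    (e : Euc n ≃ᵃ[ℝ] Euc n) : IsPolytope (e '' P) := by
  obtain ⟨s, hs, rfl⟩ := hP
  exact ⟨e '' s, hs.image e, (e.toAffineMap.image_convexHull s).symm⟩

end Faces

end CubeShelling

namespace CubeShelling

section Polar

open Filter Topology

variable {n : ℕ}

theorem lt_of_mem_interior {P : Set (Euc n)} {l : StrongDual ℝ (Euc n)} {c : ℝ} {z x : Euc n}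
    (hle : ∀ y ∈ P, l y ≤ c) (hz : z ∈ interior P) (hx : l x < c) : l z < c := by
  have hcont : ContinuousAt (fun ε : ℝ => z + ε • (z - x)) 0 := by fun_prop
  have h0 : (fun ε : ℝ => z + ε • (z - x)) 0 = z := by simp
  have hev : ∀ᶠ ε : ℝ in 𝓝[>] 0, z + ε • (z - x) ∈ P :=
    nhdsWithin_le_nhds (hcont (by rw [h0]; exact mem_interior_iff_mem_nhds.1 hz))
  obtain ⟨ε, hε, hpos⟩ := (hev.and self_mem_nhdsWithin).exists
  have hpos : 0 < ε := hpos
  have h1 := hle _ hε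
  rw [map_add, map_smul, map_sub, smul_eq_mul] at h1
  by_contra! hcz
  nlinarith

theorem convex_polarBody (P : Set (Euc n)) : Convex ℝ (polarBody P) := by
  intro y hy z hz a b ha hb hab x hx
  rw [inner_add_right, inner_smul_right, inner_smul_right]
  nlinarith [hy x hx, hz x hx]

theorem isClosed_polarBody (P : Set (Euc n)) : IsClosed (polarBody P) := by
  have : polarBody P = ⋂ x ∈ P, {y | inner ℝ x y ≤ 1} := by
    ext y; simp [polarBody]
  rw [this]
  exact isClosed_biInter fun x _ => isClosed_le (by fun_prop) continuous_const

theorem zero_mem_polarBody (P : Set (Euc n)) : (0 : Euc n) ∈ polarBody P := by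
  intro x _
  simp

theorem isCompact_polarBody {P : Set (Euc n)} (h0 : (0 : Euc n) ∈ interior P) :
    IsCompact (polarBody P) := by
  obtain ⟨r, hr, hrP⟩ := Metric.isOpen_iff.1 isOpen_interior 0 h0
  refine Metric.isCompact_of_isClosed_isBounded (isClosed_polarBody P)
    ((Metric.isBounded_closedBall (x := (0 : Euc n)) (r := 2 / r)).subset fun y hy => ?_)
  rw [mem_closedBall_zero_iff]
  rcases eq_or_ne y 0 with rfl | hy0
  · simp only [norm_zero]; positivity
  have hn : 0 < ‖y‖ := norm_pos_iff.2 hy0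
  have hmem : (r / 2 / ‖y‖) • y ∈ P := by
    refine interior_subset (hrP ?_)
    rw [mem_ball_zero_iff, norm_smul, Real.norm_of_nonneg (by positivity)]
    field_simp
    linarith
  have := hy _ hmem
  rw [inner_smul_left, real_inner_self_eq_norm_sq] at this
  simp only [conj_trivial] at this
  rw [le_div_iff₀ hr]
  have h2 : r / 2 / ‖y‖ * ‖y‖ ^ 2 = r / 2 * ‖y‖ := by field_simp
  rw [h2] at this
  linarith

theorem zero_mem_interior_polarBody {P : Set (Euc n)} (hP : IsPolytope P) :
    (0 : Euc n) ∈ interior (polarBody P) := by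
  obtain ⟨R, hR, hRP⟩ := hP.isCompact.isBounded.exists_pos_norm_le
  rw [mem_interior_iff_mem_nhds, Metric.mem_nhds_iff]
  refine ⟨1 / R, by positivity, fun y hy x hx => ?_⟩
  rw [mem_ball_zero_iff, lt_div_iff₀ hR] at hy
  have := real_inner_le_norm x y
  nlinarith [hRP x hx, norm_nonneg x, norm_nonneg y]

theorem IsPolytope.mem_polarBody_iff {P : Set (Euc n)} (hP : IsPolytope P) {y : Euc n} :
    y ∈ polarBody P ↔ ∀ v ∈ vertices P, inner ℝ v y ≤ 1 := by
  refine ⟨fun h v hv => h v (mem_of_mem_vertices hv), fun h x hx => ?_⟩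
  rw [← hP.convexHull_vertices] at hx
  refine convexHull_min (t := {x | inner ℝ x y ≤ 1}) h (fun a ha b hb s t hs ht hst => ?_) hx
  have ha : inner ℝ a y ≤ 1 := ha
  have hb : inner ℝ b y ≤ 1 := hb
  change inner ℝ (s • a + t • b) y ≤ 1
  rw [inner_add_left, inner_smul_left, inner_smul_left]
  simp only [conj_trivial]
  nlinarith

theorem IsPolytope.exists_add_smul_mem_polarBody {P : Set (Euc n)} (hP : IsPolytope P)
    {y d : Euc n} (hy : y ∈ polarBody P)
    (hd : ∀ v ∈ vertices P, inner ℝ v y = 1 → inner ℝ v d = 0) :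
    ∃ ε : ℝ, 0 < ε ∧ y + ε • d ∈ polarBody P := by
  have hev : ∀ᶠ ε : ℝ in 𝓝[>] 0, ∀ v ∈ vertices P, inner ℝ v (y + ε • d) ≤ 1 := by
    rw [eventually_all_finite hP.finite_vertices]
    intro v hv
    by_cases hvy : inner ℝ v y = 1
    · refine Eventually.of_forall fun ε => ?_
      rw [inner_add_right, inner_smul_right, hd v hv hvy, hvy]; simp
    · have hlt : inner ℝ v y < 1 := lt_of_le_of_ne (hP.mem_polarBody_iff.1 hy v hv) hvy
      have hcont : ContinuousAt (fun ε : ℝ => inner ℝ v (y + ε • d)) 0 := by fun_prop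
      have h0 : (fun ε : ℝ => inner ℝ v (y + ε • d)) 0 < 1 := by simpa using hlt
      exact nhdsWithin_le_nhds ((hcont.eventually (gt_mem_nhds h0)).mono fun _ h => h.le)
  obtain ⟨ε, hε, hpos⟩ := (hev.and self_mem_nhdsWithin).exists
  exact ⟨ε, hpos, hP.mem_polarBody_iff.2 hε⟩

theorem IsPolytope.polarBody {P : Set (Euc n)} (hP : IsPolytope P)
    (h0 : (0 : Euc n) ∈ interior P) : IsPolytope (polarBody P) := by
  have hfin : ((CubeShelling.polarBody P).extremePoints ℝ).Finite := by
    refine Set.Finite.of_finite_image (f := fun y => {v ∈ vertices P | inner ℝ v y = 1})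
      (hP.finite_vertices.finite_subsets.subset ?_) ?_
    · rintro _ ⟨y, -, rfl⟩
      exact Set.sep_subset _ _
    · intro y hy y' hy' he
      obtain ⟨ε, hε, hmem⟩ := hP.exists_add_smul_mem_polarBody (d := y - y') hy.1 (by
        intro v hv hvy
        have h1 : v ∈ {v ∈ vertices P | inner ℝ v y' = 1} := by
          rw [← show _ = {v ∈ vertices P | inner ℝ v y' = 1} from he]; exact ⟨hv, hvy⟩
        rw [inner_sub_right, hvy, h1.2, sub_self])
      refine ((mem_extremePoints_iff_left.1 hy).2 y' hy'.1 _ hmem ?_).symm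
      refine ⟨ε / (1 + ε), 1 / (1 + ε), by positivity, by positivity, by field_simp; ring, ?_⟩
      have h1 : (1 + ε) ≠ 0 := by positivity
      rw [smul_add, smul_smul, smul_sub, ← sub_eq_zero]
      match_scalars <;> field_simp <;> ring
  refine ⟨_, hfin, ?_⟩
  rw [← (hfin.isCompact_convexHull ℝ).isClosed.closure_eq]
  exact closure_convexHull_extremePoints (isCompact_polarBody h0) (convex_polarBody P)

theorem IsPolytope.polarBody_polarBody {P : Set (Euc n)} (hP : IsPolytope P)
    (h0 : (0 : Euc n) ∈ P) : CubeShelling.polarBody (CubeShelling.polarBody P) = P := by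
  apply Set.Subset.antisymm
  · intro x hx
    by_contra hxP
    obtain ⟨l, u, hlu, hul⟩ := geometric_hahn_banach_closed_point hP.convex
      hP.isCompact.isClosed hxP
    have hu : 0 < u := by simpa using hlu 0 h0
    set w := (InnerProductSpace.toDual ℝ (Euc n)).symm l with hw
    have hwl : ∀ x, inner ℝ w x = l x := fun x => InnerProductSpace.toDual_symm_apply
    have hy : u⁻¹ • w ∈ CubeShelling.polarBody P := by
      intro a ha
      rw [real_inner_comm, inner_smul_left, hwl]
      simp only [conj_trivial]
      rw [inv_mul_le_iff₀ hu, mul_one]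
      exact (hlu a ha).le
    have := hx _ hy
    rw [inner_smul_left, hwl] at this
    simp only [conj_trivial] at this
    rw [inv_mul_le_iff₀ hu, mul_one] at this
    linarith
  · intro x hx y hy
    rw [real_inner_comm]
    exact hy x hx

/-- The face of the polar that is dual to the face `F`. -/
def dualFace (P F : Set (Euc n)) : Set (Euc n) :=
  {y | y ∈ polarBody P ∧ ∀ x ∈ F, inner ℝ x y = 1}

theorem dualFace_singleton (P : Set (Euc n)) (v : Euc n) : dualFace P {v} = dualFacet P v := by
  simp [dualFace, dualFacet]

theorem exists_polar_functional {P F : Set (Euc n)} (h0 : (0 : Euc n) ∈ interior P)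
    (hF : IsExposed ℝ P F) (hne : F.Nonempty) (hFP : F ≠ P) :
    ∃ y ∈ polarBody P, F = {x ∈ P | inner ℝ x y = 1} := by
  obtain ⟨l, c, hle, rfl⟩ := exists_functional_of_isExposed hF hne
  obtain ⟨x, hx, hxc⟩ : ∃ x ∈ P, l x < c := by
    by_contra! h
    exact hFP (Set.ext fun x => ⟨fun hx => hx.1, fun hx => ⟨hx, (hle x hx).antisymm (h x hx)⟩⟩)
  have hc : 0 < c := by simpa using lt_of_mem_interior hle h0 hxc
  set w := (InnerProductSpace.toDual ℝ (Euc n)).symm l with hw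
  have hwl : ∀ x, inner ℝ x (c⁻¹ • w) = c⁻¹ * l x := fun x => by
    rw [inner_smul_right, real_inner_comm]
    congr 1
    exact InnerProductSpace.toDual_symm_apply
  refine ⟨c⁻¹ • w, fun a ha => ?_, ?_⟩
  · rw [hwl, inv_mul_le_iff₀ hc, mul_one]
    exact hle a ha
  · ext a
    refine and_congr_right fun _ => ?_
    rw [hwl, inv_mul_eq_one₀ hc.ne', eq_comm]

theorem isExposed_dualFace {P F : Set (Euc n)} (hP : IsPolytope P) (hF : IsExposed ℝ P F) :
    IsExposed ℝ (polarBody P) (dualFace P F) := by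
  rcases F.eq_empty_or_nonempty with rfl | hne
  · have : dualFace P ∅ = polarBody P :=
      Set.ext fun y => ⟨fun h => h.1, fun h => ⟨h, fun _ hx => hx.elim⟩⟩
    rw [this]
  · obtain ⟨x, hxF, hx⟩ := hP.exists_mem_forall_face hF hne
    convert isExposed_of_forall_le (P := polarBody P) (l := innerSL ℝ x) (c := 1)
      (fun y hy => hy x (hF.subset hxF)) using 1
    ext y
    refine and_congr_right fun hy => ⟨fun h => h x hxF, fun h z hz => ?_⟩
    have hE : IsExposed ℝ P {z ∈ P | innerSL ℝ y z = 1} := isExposed_of_forall_le fun z hz => by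
      rw [innerSL_apply_apply, real_inner_comm]
      exact hy z hz
    have := (hx _ hE ⟨hF.subset hxF, by rw [innerSL_apply_apply, real_inner_comm]; exact h⟩ hz).2
    rwa [innerSL_apply_apply, real_inner_comm] at this

theorem dualFace_dualFace {P F : Set (Euc n)} (hP : IsPolytope P)
    (h0 : (0 : Euc n) ∈ interior P) (hF : IsExposed ℝ P F) :
    dualFace (polarBody P) (dualFace P F) = F := by
  have hPP := hP.polarBody_polarBody (interior_subset h0)
  apply Set.Subset.antisymm
  · rintro x ⟨hx, hxF⟩
    rw [hPP] at hx
    rcases F.eq_empty_or_nonempty with rfl | hne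
    · have h1 : inner ℝ (0 : Euc n) x = 1 := hxF 0 ⟨zero_mem_polarBody P, fun _ h => h.elim⟩
      rw [inner_zero_left] at h1
      exact absurd h1 zero_ne_one
    · by_cases hFP : F = P
      · rwa [hFP]
      · obtain ⟨y, hy, hFy⟩ := exists_polar_functional h0 hF hne hFP
        rw [hFy]
        refine ⟨hx, ?_⟩
        rw [real_inner_comm]
        refine hxF y ⟨hy, fun a ha => ?_⟩
        rw [hFy] at ha
        exact ha.2
  · intro x hx
    refine ⟨by rw [hPP]; exact hF.subset hx, fun y hy => ?_⟩
    rw [real_inner_comm]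
    exact hy.2 x hx

theorem dualFace_anti {P F G : Set (Euc n)} (h : F ⊆ G) : dualFace P G ⊆ dualFace P F :=
  fun _ hy => ⟨hy.1, fun x hx => hy.2 x (h hx)⟩

/-- The face lattices of a polytope and of its polar are anti-isomorphic. -/
noncomputable def polarIso {P : Set (Euc n)} (hP : IsPolytope P)
    (h0 : (0 : Euc n) ∈ interior P) : Face P ≃o (Face (polarBody P))ᵒᵈ where
  toFun F := OrderDual.toDual ⟨dualFace P F.1, isExposed_dualFace hP F.2⟩
  invFun G := ⟨dualFace (polarBody P) (OrderDual.ofDual G).1, by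
    have := isExposed_dualFace (hP.polarBody h0) (OrderDual.ofDual G).2
    rwa [hP.polarBody_polarBody (interior_subset h0)] at this⟩
  left_inv F := Subtype.ext (dualFace_dualFace hP h0 F.2)
  right_inv G := by
    refine congrArg OrderDual.toDual (Subtype.ext ?_)
    have := dualFace_dualFace (hP.polarBody h0) (zero_mem_interior_polarBody hP)
      (OrderDual.ofDual G).2
    rwa [hP.polarBody_polarBody (interior_subset h0)] at this
  map_rel_iff' {F G} := by
    refine ⟨fun h => ?_, fun h => dualFace_anti h⟩
    have h' : dualFace P G.1 ⊆ dualFace P F.1 := h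
    have := dualFace_anti (P := polarBody P) h'
    rwa [dualFace_dualFace hP h0 F.2, dualFace_dualFace hP h0 G.2] at this

theorem dualFacet_mem_facets {P : Set (Euc n)} (hP : IsPolytope P)
    (h0 : (0 : Euc n) ∈ interior P) {v : Euc n} (hv : v ∈ vertices P) :
    dualFacet P v ∈ facets (polarBody P) := by
  have h1 : IsAtom (polarIso hP h0 ⟨{v}, hv⟩) :=
    (OrderIso.isAtom_iff _ _).2 (isAtom_singleton hv)
  have h2 : IsCoatom (OrderDual.ofDual (polarIso hP h0 ⟨{v}, hv⟩)) := isAtom_dual_iff_isCoatom.1 h1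
  have h3 := (isCoatom_iff_mem_facets _).1 h2
  rwa [← dualFace_singleton]

theorem bijOn_dualFacet {P : Set (Euc n)} (hP : IsPolytope P) (h0 : (0 : Euc n) ∈ interior P) :
    Set.BijOn (dualFacet P) (vertices P) (facets (polarBody P)) := by
  refine ⟨fun v hv => dualFacet_mem_facets hP h0 hv, fun v hv w hw h => ?_, fun G hG => ?_⟩
  · rw [← dualFace_singleton, ← dualFace_singleton] at h
    have := congrArg (dualFace (polarBody P)) h
    rw [dualFace_dualFace hP h0 hv, dualFace_dualFace hP h0 hw] at this
    exact Set.singleton_injective this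
  · have hc : IsCoatom (⟨G, hG.1.1⟩ : Face (polarBody P)) := (isCoatom_iff_mem_facets _).2 hG
    have ha : IsAtom ((polarIso hP h0).symm (OrderDual.toDual ⟨G, hG.1.1⟩)) :=
      (OrderIso.isAtom_iff _ _).2 hc.dual
    obtain ⟨v, hv, hvG⟩ := (hP.isAtom_iff _).1 ha
    refine ⟨v, hv, ?_⟩
    have h1 : (polarIso hP h0).symm (OrderDual.toDual ⟨G, hG.1.1⟩) = ⟨{v}, hv⟩ := Subtype.ext hvG
    rw [OrderIso.symm_apply_eq] at h1
    rw [← dualFace_singleton]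
    exact (congrArg (fun x => (OrderDual.ofDual x).1) h1).symm

/-- The facets of the polar span the hyperplanes dual to the vertices. -/
theorem mem_affineSpan_dualFacet_iff {P : Set (Euc n)} (hP : IsPolytope P)
    (h0 : (0 : Euc n) ∈ interior P) {v : Euc n} (hv : v ∈ vertices P) {y : Euc n} :
    y ∈ affineSpan ℝ (dualFacet P v) ↔ inner ℝ v y = 1 := by
  constructor
  · intro hy
    refine affineSpan_induction (p := fun y => inner ℝ v y = 1) hy (fun y hy => hy.2)
      fun c a b d ha hb hd => ?_
    rw [vsub_eq_sub, vadd_eq_add, inner_add_right, inner_smul_right, inner_sub_right, ha, hb, hd]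
    simp
  · intro hy
    set G := dualFacet P v with hG
    have hK := hP.polarBody h0
    have hPP := hP.polarBody_polarBody (interior_subset h0)
    have hspan : Submodule.span ℝ G = ⊤ := by
      rw [← Submodule.orthogonal_eq_bot_iff, Submodule.eq_bot_iff]
      intro w hw
      rw [Submodule.mem_orthogonal] at hw
      have hvK : v ∈ polarBody (polarBody P) := by rw [hPP]; exact mem_of_mem_vertices hv
      obtain ⟨ε, hε, hmem⟩ := hK.exists_add_smul_mem_polarBody (d := w) hvK (by
        intro z hz hzv
        refine hw z (Submodule.subset_span ⟨mem_of_mem_vertices hz, ?_⟩)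
        rw [real_inner_comm]; exact hzv)
      have hdd := dualFace_dualFace hP h0 hv
      rw [dualFace_singleton] at hdd
      have h1 : v + ε • w ∈ dualFace (polarBody P) (dualFacet P v) := by
        refine ⟨hmem, fun z hz => ?_⟩
        rw [inner_add_right, inner_smul_right, hw z (Submodule.subset_span hz), real_inner_comm,
          hz.2]
        simp
      rw [hdd] at h1
      have h2 : ε • w = 0 := by simpa using h1
      exact (smul_eq_zero.1 h2).resolve_left hε.ne'
    have hyG : y ∈ Submodule.span ℝ G := hspan ▸ Submodule.mem_top
    obtain ⟨a, t, htG, -, rfl⟩ := Submodule.mem_span_iff_exists_finset_subset.1 hyG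
    have hsum : ∑ z ∈ t, a z = 1 := by
      rw [inner_sum] at hy
      rw [← hy]
      refine Finset.sum_congr rfl fun z hz => ?_
      rw [inner_smul_right, (htG hz).2, mul_one]
    have hcomb : t.affineCombination ℝ id a = ∑ z ∈ t, a z • z :=
      Finset.affineCombination_eq_linear_combination t id a hsum
    rw [← hcomb]
    have := affineCombination_mem_affineSpan_image hsum (s' := G)
      (fun i hi hiG => absurd (htG hi) hiG) id
    rwa [Set.image_id] at this

theorem passedBefore_iff {a b s t : ℝ} (hs : s * a = -1) (ht : t * b = -1) :
    PassedBefore s t ↔ a < b := by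
  have hs0 : s ≠ 0 := by rintro rfl; simp at hs
  have ht0 : t ≠ 0 := by rintro rfl; simp at ht
  obtain rfl : a = -s⁻¹ := by field_simp; linarith
  obtain rfl : b = -t⁻¹ := by field_simp; linarith
  rw [neg_lt_neg_iff, PassedBefore]
  rcases lt_or_gt_of_ne hs0 with h1 | h1 <;> rcases lt_or_gt_of_ne ht0 with h2 | h2
  · rw [inv_lt_inv_of_neg h2 h1]
    constructor
    · rintro (h | h | h) <;> linarith
    · intro h; exact Or.inr (Or.inr ⟨h, h2⟩)
  · have h3 := inv_lt_zero.2 h1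
    have h4 := inv_pos.2 h2
    constructor
    · rintro (h | h | h) <;> linarith
    · intro h; linarith
  · have h3 := inv_pos.2 h1
    have h4 := inv_lt_zero.2 h2
    exact ⟨fun _ => by linarith, fun _ => Or.inr (Or.inl ⟨h1, h2⟩)⟩
  · rw [inv_lt_inv₀ h2 h1]
    constructor
    · rintro (h | h | h) <;> linarith
    · intro h; exact Or.inl ⟨h1, h⟩

/-- An ordering of the vertices by a linear functional corresponds to a line shelling of the
polar. -/
theorem isLineShellingAlong_polarBody_iff {P : Set (Euc n)} (hP : IsPolytope P)
    (h0 : (0 : Euc n) ∈ interior P) (f : Euc n) {m : ℕ} {v : Fin m → Euc n}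
    (hv : IsVertexOrdering P v) :
    ((∀ i, inner ℝ f (v i) ≠ 0) ∧ ∀ i j, i < j → inner ℝ f (v i) < inner ℝ f (v j)) ↔
      IsLineShellingAlong (polarBody P) 0 (-f) (fun i => dualFacet P (v i)) := by
  have hvm : ∀ i, v i ∈ vertices P := fun i => hv.2 ▸ Set.mem_range_self i
  have hord : IsFacetOrdering (polarBody P) (fun i => dualFacet P (v i)) := by
    have hb := bijOn_dualFacet hP h0
    refine ⟨fun i j h => hv.1 (hb.injOn (hvm i) (hvm j) h), ?_⟩
    rw [← hb.image_eq, ← hv.2, ← Set.range_comp]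
    rfl
  have hmem : ∀ i (t : ℝ), (0 : Euc n) + t • (-f) ∈ affineSpan ℝ (dualFacet P (v i)) ↔
      t * inner ℝ f (v i) = -1 := by
    intro i t
    rw [mem_affineSpan_dualFacet_iff hP h0 (hvm i), zero_add, inner_smul_right, inner_neg_right,
      real_inner_comm]
    constructor <;> intro h <;> linarith
  constructor
  · rintro ⟨hne, hlt⟩
    have ht : ∀ i, -(inner ℝ f (v i))⁻¹ * inner ℝ f (v i) = -1 := fun i => by
      have := hne i
      field_simp
    exact ⟨zero_mem_interior_polarBody hP, hord, fun i => -(inner ℝ f (v i))⁻¹,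
      fun i => (hmem i _).2 (ht i), fun i j hij => (passedBefore_iff (ht i) (ht j)).2 (hlt i j hij)⟩
  · rintro ⟨-, -, t, ht, hlt⟩
    refine ⟨fun i h => ?_, fun i j hij =>
      (passedBefore_iff ((hmem i _).1 (ht i)) ((hmem j _).1 (ht j))).1 (hlt i j hij)⟩
    have := (hmem i _).1 (ht i)
    rw [h] at this
    simp at this

end Polar

end CubeShelling

namespace CubeShelling

section Crosspolytopes

variable {n : ℕ} {ι κ : Type*}

/-- A set of labels without a pair of antipodal labels. -/
def AntipodeFree (star : ι → ι) (S : Set ι) : Prop := ∀ i ∈ S, star i ∉ S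

/-- `C` is the convex hull of the points `v i`, and the sets of labels of its faces are the sets
without antipodal labels and the set of all labels. -/
structure CrossFaces (C : Set (Euc n)) (v : ι → Euc n) (star : ι → ι) : Prop where
  hull : convexHull ℝ (Set.range v) = C
  faces : ∀ S : Set ι, (∃ F, IsExposed ℝ C F ∧ v ⁻¹' F = S) ↔ (S = Set.univ ∨ AntipodeFree star S)

namespace CrossFaces

variable {C C' : Set (Euc n)} {v : ι → Euc n} {star : ι → ι}

theorem isPolytope [Finite ι] (h : CrossFaces C v star) : IsPolytope C :=
  ⟨_, Set.finite_range v, h.hull⟩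

theorem mem (h : CrossFaces C v star) (i : ι) : v i ∈ C :=
  h.hull ▸ subset_convexHull ℝ _ (Set.mem_range_self i)

theorem hull_face [Finite ι] (h : CrossFaces C v star) {F : Set (Euc n)} (hF : IsExposed ℝ C F) :
    convexHull ℝ (v '' (v ⁻¹' F)) = F := by
  rw [Set.image_preimage_eq_range_inter]
  exact convexHull_inter_face (Set.finite_range v) (by rwa [h.hull])

theorem subset_iff [Finite ι] (h : CrossFaces C v star) {F G : Set (Euc n)}
    (hF : IsExposed ℝ C F) (hG : IsExposed ℝ C G) : F ⊆ G ↔ v ⁻¹' F ⊆ v ⁻¹' G := by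
  refine ⟨fun hFG => Set.preimage_mono hFG, fun hFG => ?_⟩
  rw [← h.hull_face hF, ← h.hull_face hG]
  exact convexHull_mono (Set.image_mono hFG)

theorem eq_iff [Finite ι] (h : CrossFaces C v star) {F G : Set (Euc n)}
    (hF : IsExposed ℝ C F) (hG : IsExposed ℝ C G) : F = G ↔ v ⁻¹' F = v ⁻¹' G := by
  rw [Set.Subset.antisymm_iff, Set.Subset.antisymm_iff, h.subset_iff hF hG, h.subset_iff hG hF]

theorem antipodeFree_singleton (hs : ∀ i, star i ≠ i) (i : ι) : AntipodeFree star {i} := by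
  rintro j rfl
  exact hs j

theorem singleton_face [Finite ι] (h : CrossFaces C v star) (hs : ∀ i, star i ≠ i) (i : ι) :
    IsExposed ℝ C {v i} ∧ v ⁻¹' {v i} = {i} := by
  obtain ⟨F, hF, hFi⟩ := (h.faces {i}).2 (Or.inr (antipodeFree_singleton hs i))
  have := h.hull_face hF
  rw [hFi, Set.image_singleton, convexHull_singleton] at this
  subst this
  exact ⟨hF, hFi⟩

theorem injective [Finite ι] (h : CrossFaces C v star) (hs : ∀ i, star i ≠ i) :
    Function.Injective v := by
  intro i j hij
  have : i ∈ v ⁻¹' {v j} := hij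
  rw [(h.singleton_face hs j).2] at this
  exact this

theorem range_eq [Finite ι] (h : CrossFaces C v star) (hs : ∀ i, star i ≠ i) :
    Set.range v = vertices C := by
  apply Set.Subset.antisymm
  · rintro _ ⟨i, rfl⟩
    exact (h.singleton_face hs i).1
  · rw [← h.hull]
    exact vertices_subset_of_convexHull

theorem comp_equiv (h : CrossFaces C v star) (e : κ ≃ ι) :
    CrossFaces C (v ∘ e) (fun k => e.symm (star (e k))) where
  hull := by rw [e.surjective.range_comp, h.hull]
  faces S := by
    have hS : ∀ T : Set ι, e ⁻¹' T = S ↔ T = e '' S := by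
      intro T
      constructor
      · rintro rfl; rw [e.image_preimage]
      · rintro rfl; rw [e.preimage_image]
    have h1 : (∃ F, IsExposed ℝ C F ∧ v ∘ e ⁻¹' F = S) ↔
        ∃ F, IsExposed ℝ C F ∧ v ⁻¹' F = e '' S := by
      simp only [Set.preimage_comp, hS]
    rw [h1, h.faces]
    refine or_congr ?_ ?_
    · constructor
      · intro h; rw [← (hS _).2 h.symm, Set.preimage_univ]
      · rintro rfl; exact e.surjective.range_eq ▸ Set.image_univ
    · constructor
      · intro hf k hk hk'
        refine hf (e k) ⟨k, hk, rfl⟩ ⟨_, hk', ?_⟩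
        simp
      · rintro hf _ ⟨k, hk, rfl⟩ ⟨k', hk', h'⟩
        refine hf k hk ?_
        change e.symm (star (e k)) ∈ S
        rwa [← h', e.symm_apply_apply]

/-- Transport along an isomorphism of face lattices. -/
theorem transport [Finite ι] (h : CrossFaces C v star) (hs : ∀ i, star i ≠ i)
    (hC' : IsPolytope C') (ψ : Face C ≃o Face C') {v' : ι → Euc n}
    (hv : ∀ i, ∃ hx : IsExposed ℝ C {v i}, (ψ ⟨{v i}, hx⟩ : Set (Euc n)) = {v' i}) :
    CrossFaces C' v' star where
  hull := by
    apply Set.Subset.antisymm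
    · refine convexHull_min ?_ hC'.convex
      rintro _ ⟨i, rfl⟩
      obtain ⟨hx, hi⟩ := hv i
      have := (ψ ⟨{v i}, hx⟩).2.subset
      rw [hi] at this
      exact this rfl
    · conv_lhs => rw [← hC'.convexHull_vertices]
      refine convexHull_mono fun w hw => ?_
      have ha : IsAtom (ψ.symm ⟨{w}, hw⟩) := (OrderIso.isAtom_iff _ _).2 (isAtom_singleton hw)
      obtain ⟨u, hu, huw⟩ := (h.isPolytope.isAtom_iff _).1 ha
      rw [← h.range_eq hs] at hu
      obtain ⟨i, rfl⟩ := hu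
      obtain ⟨hx, hi⟩ := hv i
      have h1 : ψ.symm ⟨{w}, hw⟩ = ⟨{v i}, hx⟩ := Subtype.ext huw
      rw [OrderIso.symm_apply_eq] at h1
      rw [← h1] at hi
      exact ⟨i, (Set.singleton_injective hi).symm⟩
  faces S := by
    have key : ∀ F : Face C, v' ⁻¹' (ψ F) = v ⁻¹' F.1 := by
      intro F
      ext i
      obtain ⟨hx, hi⟩ := hv i
      have h1 : (⟨{v i}, hx⟩ : Face C) ≤ F ↔ ψ ⟨{v i}, hx⟩ ≤ ψ F := ψ.le_iff_le.symm
      rw [← Subtype.coe_le_coe, ← Subtype.coe_le_coe, hi] at h1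
      change v' i ∈ (ψ F).1 ↔ v i ∈ F.1
      rw [← Set.singleton_subset_iff, ← Set.singleton_subset_iff]
      exact h1.symm
    rw [← h.faces]
    constructor
    · rintro ⟨F, hF, rfl⟩
      refine ⟨_, (ψ.symm ⟨F, hF⟩).2, ?_⟩
      rw [← key, ψ.apply_symm_apply]
    · rintro ⟨F, hF, rfl⟩
      exact ⟨_, (ψ ⟨F, hF⟩).2, key ⟨F, hF⟩⟩

/-- The face lattice is determined by the sets of labels. -/
noncomputable def labelIso [Finite ι] (h : CrossFaces C v star) :
    Face C ≃o {S : Set ι // S = Set.univ ∨ AntipodeFree star S} :=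
  RelIso.ofSurjective
    (OrderEmbedding.ofMapLEIff (fun F : Face C => (⟨v ⁻¹' F.1, (h.faces _).1 ⟨F.1, F.2, rfl⟩⟩ :
      {S : Set ι // S = Set.univ ∨ AntipodeFree star S}))
      fun F G => (h.subset_iff F.2 G.2).symm)
    fun S => by
      obtain ⟨F, hF, hS⟩ := (h.faces S.1).2 S.2
      exact ⟨⟨F, hF⟩, Subtype.ext hS⟩

theorem labelIso_apply [Finite ι] (h : CrossFaces C v star) (F : Face C) :
    (h.labelIso F : Set ι) = v ⁻¹' F.1 := rfl

theorem exists_iso [Finite ι] (h : CrossFaces C v star) (hs : ∀ i, star i ≠ i) {v' : ι → Euc n}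
    (h' : CrossFaces C' v' star) : ∃ ψ : Face C ≃o Face C',
      ∀ i, ∃ hx : IsExposed ℝ C {v i}, (ψ ⟨{v i}, hx⟩ : Set (Euc n)) = {v' i} := by
  refine ⟨h.labelIso.trans h'.labelIso.symm, fun i => ⟨(h.singleton_face hs i).1, ?_⟩⟩
  have h1 : h'.labelIso ⟨{v' i}, (h'.singleton_face hs i).1⟩ =
      h.labelIso ⟨{v i}, (h.singleton_face hs i).1⟩ := by
    apply Subtype.ext
    rw [labelIso_apply, labelIso_apply, (h.singleton_face hs i).2, (h'.singleton_face hs i).2]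
  rw [OrderIso.trans_apply, ← h1, OrderIso.symm_apply_apply]

theorem of_functionals [Finite ι] (v : ι → Euc n) (star : ι → ι)
    (ha : ∀ S, AntipodeFree star S → ∃ (l : StrongDual ℝ (Euc n)) (c : ℝ),
      (∀ i ∈ S, l (v i) = c) ∧ ∀ i ∉ S, l (v i) < c)
    (hb : ∀ (l : StrongDual ℝ (Euc n)) (c : ℝ), (∀ i, l (v i) ≤ c) →
      ∀ i, l (v i) = c → l (v (star i)) = c → ∀ j, l (v j) = c) :
    CrossFaces (convexHull ℝ (Set.range v)) v star where
  hull := rfl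
  faces S := by
    have hmem : ∀ i, v i ∈ convexHull ℝ (Set.range v) := fun i =>
      subset_convexHull ℝ _ (Set.mem_range_self i)
    constructor
    · rintro ⟨F, hF, rfl⟩
      rw [or_iff_not_imp_right]
      intro hS
      rw [AntipodeFree] at hS
      push Not at hS
      obtain ⟨i, hi, hi'⟩ := hS
      obtain ⟨l, c, hle, rfl⟩ := exists_functional_of_isExposed hF ⟨_, hi⟩
      exact Set.eq_univ_of_forall fun j =>
        ⟨hmem j, hb l c (fun i => hle _ (hmem i)) i hi.2 hi'.2 j⟩
    · rintro (rfl | hS)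
      · exact ⟨_, IsExposed.refl _, Set.eq_univ_of_forall hmem⟩
      · obtain ⟨l, c, h1, h2⟩ := ha S hS
        have hle : ∀ x ∈ convexHull ℝ (Set.range v), l x ≤ c := by
          intro x hx
          refine convexHull_min (t := {x | l x ≤ c}) ?_ (convex_halfSpace_le l.isLinear _) hx
          rintro _ ⟨i, rfl⟩
          by_cases hi : i ∈ S
          · exact (h1 i hi).le
          · exact (h2 i hi).le
        refine ⟨_, isExposed_of_forall_le hle, Set.ext fun i => ⟨fun hi => ?_, fun hi => ?_⟩⟩
        · by_contra hiS
          exact (h2 i hiS).ne hi.2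
        · exact ⟨hmem i, h1 i hi⟩

theorem exists_functional (h : CrossFaces C v star) {S : Set ι} (hS : AntipodeFree star S)
    (hne : S.Nonempty) : ∃ (l : StrongDual ℝ (Euc n)) (c : ℝ),
      (∀ x ∈ C, l x ≤ c) ∧ (∀ i ∈ S, l (v i) = c) ∧ ∀ i ∉ S, l (v i) < c := by
  obtain ⟨F, hF, rfl⟩ := (h.faces S).2 (Or.inr hS)
  obtain ⟨i, hi⟩ := hne
  obtain ⟨l, c, hle, rfl⟩ := exists_functional_of_isExposed hF ⟨_, hi⟩
  exact ⟨l, c, hle, fun i hi => hi.2, fun i hi =>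
    lt_of_le_of_ne (hle _ (h.mem i)) fun hc => hi ⟨h.mem i, hc⟩⟩

end CrossFaces

/-- The vertices of the standard crosspolytope. -/
noncomputable def stdVertex (n : ℕ) (p : Fin n × Bool) : Euc n :=
  (if p.2 then (1 : ℝ) else -1) • EuclideanSpace.single p.1 (1 : ℝ)

theorem range_stdVertex (n : ℕ) : Set.range (stdVertex n) =
    {x | ∃ i, x = EuclideanSpace.single i (1 : ℝ) ∨ x = -EuclideanSpace.single i (1 : ℝ)} := by
  ext x
  constructor
  · rintro ⟨⟨i, b⟩, rfl⟩
    refine ⟨i, ?_⟩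
    cases b <;> simp [stdVertex]
  · rintro ⟨i, rfl | rfl⟩
    · exact ⟨(i, true), by simp [stdVertex]⟩
    · exact ⟨(i, false), by simp [stdVertex]⟩

theorem crossFaces_std (n : ℕ) :
    CrossFaces (stdCrosspolytope n) (stdVertex n) (fun p => (p.1, !p.2)) := by
  classical
  rw [stdCrosspolytope, ← range_stdVertex]
  refine CrossFaces.of_functionals _ _ (fun S hS => ?_) (fun l c hle i hi hi' j => ?_)
  · set w : Euc n := WithLp.toLp 2 fun i =>
      if (i, true) ∈ S then (1 : ℝ) else if (i, false) ∈ S then -1 else 0 with hw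
    have hwi : ∀ p, innerSL ℝ w (stdVertex n p) = (if p.2 then (1 : ℝ) else -1) *
        (if (p.1, true) ∈ S then (1 : ℝ) else if (p.1, false) ∈ S then -1 else 0) := by
      intro p
      rw [innerSL_apply_apply, stdVertex, inner_smul_right, EuclideanSpace.inner_single_right]
      simp [hw]
    refine ⟨innerSL ℝ w, 1, fun p hp => ?_, fun p hp => ?_⟩
    · rw [hwi]
      obtain ⟨i, b⟩ := p
      have := hS _ hp
      cases b <;> simp_all
    · rw [hwi]
      obtain ⟨i, b⟩ := p
      cases b <;> by_cases h1 : (i, true) ∈ S <;> by_cases h2 : (i, false) ∈ S <;>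
        simp_all
  · have hneg : ∀ p : Fin n × Bool, stdVertex n (p.1, !p.2) = -stdVertex n p := by
      rintro ⟨i, b⟩
      cases b <;> simp [stdVertex]
    have hc : c = 0 := by
      rw [hneg, map_neg] at hi'
      linarith
    have h1 := hle j
    have h2 := hle (j.1, !j.2)
    rw [hneg, map_neg] at h2
    linarith

theorem IsCrosspolytope.exists_crossFaces {C : Set (Euc n)} (hC : IsCrosspolytope C)
    {v : Fin (2 * n) → Euc n} (hv : IsVertexOrdering C v) :
    ∃ star : Fin (2 * n) → Fin (2 * n), Function.Involutive star ∧ (∀ i, star i ≠ i) ∧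
      CrossFaces C v star := by
  obtain ⟨hP, ⟨ψ⟩⟩ := hC
  have hstd := crossFaces_std n
  have hs : ∀ p : Fin n × Bool, (p.1, !p.2) ≠ p := by
    rintro ⟨i, b⟩; cases b <;> simp
  have hvm : ∀ i, v i ∈ vertices C := fun i => hv.2 ▸ Set.mem_range_self i
  have h1 : ∀ i, ∃ p, (ψ ⟨{v i}, hvm i⟩ : Set (Euc n)) = {stdVertex n p} := by
    intro i
    have ha : IsAtom (ψ ⟨{v i}, hvm i⟩) := (OrderIso.isAtom_iff _ _).2 (isAtom_singleton (hvm i))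
    obtain ⟨u, hu, hui⟩ := (hstd.isPolytope.isAtom_iff _).1 ha
    rw [← hstd.range_eq hs] at hu
    obtain ⟨p, rfl⟩ := hu
    exact ⟨p, hui⟩
  choose e he using h1
  have hinj : Function.Injective e := by
    intro i j hij
    have h2 : (ψ ⟨{v i}, hvm i⟩) = ψ ⟨{v j}, hvm j⟩ :=
      Subtype.ext ((he i).trans (by rw [hij, he j]))
    have h3 := congrArg Subtype.val (ψ.injective h2)
    exact hv.1 (Set.singleton_injective h3)
  have hbij : Function.Bijective e := by
    rw [Fintype.bijective_iff_injective_and_card]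
    refine ⟨hinj, ?_⟩
    simp [mul_comm]
  set E := Equiv.ofBijective e hbij with hE
  refine ⟨fun k => E.symm ((E k).1, !(E k).2), fun k => ?_, fun k h => ?_, ?_⟩
  · simp
  · rw [Equiv.symm_apply_eq] at h
    exact hs _ h
  · refine (hstd.comp_equiv E).transport (fun k h => ?_) hP ψ.symm fun i => ?_
    · rw [Equiv.symm_apply_eq] at h
      exact hs _ h
    · refine ⟨(hstd.singleton_face hs _).1, ?_⟩
      have h2 : ψ ⟨{v i}, hvm i⟩ =
          ⟨{(stdVertex n ∘ E) i}, (hstd.singleton_face hs _).1⟩ := Subtype.ext (he i)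
      rw [← h2, OrderIso.symm_apply_apply]

/-- The smaller labels of the antipodal pairs, in ascending order. -/
theorem exists_pairs {star : Fin (2 * n) → Fin (2 * n)} (hinv : Function.Involutive star)
    (hs : ∀ i, star i ≠ i) :
    ∃ a : Fin n → Fin (2 * n), StrictMono a ∧ ∀ i, (∃ k, a k = i) ↔ i < star i := by
  classical
  set A : Finset (Fin (2 * n)) := Finset.univ.filter fun i => i < star i with hA
  set B : Finset (Fin (2 * n)) := Finset.univ.filter fun i => ¬ i < star i with hB
  have hAB : A.card + B.card = 2 * n := by
    rw [hA, hB, Finset.card_filter_add_card_filter_not, Finset.card_univ, Fintype.card_fin]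
  have hcard : A.card = B.card := by
    refine Finset.card_bij (fun i _ => star i) ?_ (fun i _ j _ h => hinv.injective h) ?_
    · intro i hi
      simp only [hA, hB, Finset.mem_filter, Finset.mem_univ, true_and] at *
      rw [hinv]; exact hi.le.not_gt
    · intro i hi
      refine ⟨star i, ?_, hinv i⟩
      simp only [hA, hB, Finset.mem_filter, Finset.mem_univ, true_and] at *
      rw [hinv]; exact lt_of_le_of_ne (not_lt.1 hi) (hs i)
  have hAn : A.card = n := by omega
  refine ⟨A.orderEmbOfFin hAn, (A.orderEmbOfFin hAn).strictMono, fun i => ?_⟩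
  have := A.range_orderEmbOfFin hAn
  have h2 : (∃ k, A.orderEmbOfFin hAn k = i) ↔ i ∈ Set.range (A.orderEmbOfFin hAn) := Iff.rfl
  rw [h2, this]
  simp [hA]

/-- A realization of the combinatorial crosspolytope in `ℝⁿ` is full-dimensional. -/
theorem CrossFaces.interior_nonempty {C : Set (Euc n)} {v : Fin (2 * n) → Euc n}
    {star : Fin (2 * n) → Fin (2 * n)} (h : CrossFaces C v star)
    (hinv : Function.Involutive star) (hs : ∀ i, star i ≠ i) (hn : 0 < n) :
    (interior C).Nonempty := by
  obtain ⟨a, hmono, ha⟩ := exists_pairs hinv hs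
  have hlt : ∀ k, a k < star (a k) := fun k => (ha _).1 ⟨k, rfl⟩
  have hstar : ∀ k k', star (a k) ≠ a k' := by
    intro k k' hk
    have h1 := hlt k
    have h2 := hlt k'
    rw [← hk, hinv] at h2
    exact lt_asymm h1 h2
  rw [h.isPolytope.convex.interior_nonempty_iff_affineSpan_eq_top]
  let z : Fin n := ⟨0, hn⟩
  set w : Fin n → Euc n := fun k => v (a k) - v (star (a z)) with hw
  have hli : LinearIndependent ℝ w := by
    rw [Fintype.linearIndependent_iff]
    intro g hg
    have key : ∀ k, (∀ k', k' ≠ k → k' = z → g k' = 0) → g k = 0 := by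
      intro k hk
      obtain ⟨l, c, -, h1, h2⟩ := h.exists_functional
        (S := insert (star (a z)) {i | ∃ k', k' ≠ k ∧ k' ≠ z ∧ i = a k'}) (by
          rintro i (rfl | ⟨k', h1, h2, rfl⟩) hi'
          · rw [hinv] at hi'
            rcases hi' with hi' | ⟨k'', -, h3, h4⟩
            · exact hs _ hi'.symm
            · exact h3 (hmono.injective h4).symm
          · rcases hi' with hi' | ⟨k'', -, -, h4⟩
            · exact h2 (hmono.injective (hinv.injective hi'))
            · exact hstar _ _ h4) ⟨_, Or.inl rfl⟩
      have hsum : ∑ k', g k' * l (w k') = 0 := by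
        have := congrArg l hg
        simpa using this
      rw [Finset.sum_eq_single k] at hsum
      · refine (mul_eq_zero.1 hsum).resolve_right ?_
        rw [hw]
        simp only [map_sub]
        rw [h1 _ (Or.inl rfl)]
        refine (sub_neg.2 (h2 _ ?_)).ne
        rintro (h3 | ⟨k', h3, -, h4⟩)
        · exact hstar _ _ h3.symm
        · exact h3 (hmono.injective h4).symm
      · intro k' _ hk'
        by_cases hz : k' = z
        · rw [hk k' hk' hz, zero_mul]
        · rw [hw]
          simp only [map_sub]
          rw [h1 _ (Or.inl rfl), h1 (a k') (Or.inr ⟨k', hk', hz, rfl⟩), sub_self, mul_zero]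
      · simp
    have hz : g z = 0 := key z fun k' h1 h2 => absurd h2 h1
    exact fun k => key k fun k' _ h2 => h2 ▸ hz
  have hsub : Set.range w ⊆ vectorSpan ℝ C := by
    rintro _ ⟨k, rfl⟩
    exact vsub_mem_vectorSpan ℝ (h.mem _) (h.mem _)
  have htop : Submodule.span ℝ (Set.range w) = ⊤ :=
    hli.span_eq_top_of_card_eq_finrank' (by simp)
  have hvs : vectorSpan ℝ C = ⊤ := top_le_iff.1 (htop ▸ Submodule.span_le.2 hsub)
  exact (AffineSubspace.affineSpan_eq_top_iff_vectorSpan_eq_top_of_nonempty ℝ (Euc n) (Euc n)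
    ⟨_, h.mem (a z)⟩).2 hvs

end Crosspolytopes

end CubeShelling

namespace CubeShelling

section Orders

variable {n : ℕ} {ι : Type*}

/-- No proper nonempty initial segment of the ordering `a` is closed under taking antipodes. -/
def IsGoodOrder (star : ι → ι) {m : ℕ} (a : Fin m → ι) : Prop :=
  ∀ j : ℕ, 0 < j → j < m → ∃ k : Fin m, k.1 < j ∧ ∀ k' : Fin m, k'.1 < j → a k' ≠ star (a k)

theorem CrossFaces.isAntipodal_iff [Finite ι] {C : Set (Euc n)} {v : ι → Euc n} {star : ι → ι}
    (h : CrossFaces C v star) (hinv : Function.Involutive star) (hs : ∀ i, star i ≠ i) (i j : ι) :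
    IsAntipodal C (v i) (v j) ↔ j = star i := by
  constructor
  · intro hA
    by_contra hne
    have hS : AntipodeFree star {i, j} := by
      rintro k (rfl | rfl) (hk | hk)
      · exact hs _ hk
      · exact hne hk.symm
      · exact hne (by rw [← hk, hinv])
      · exact hs _ hk
    obtain ⟨G, hG, hGS⟩ := (h.faces _).2 (Or.inr hS)
    have hi : i ∈ v ⁻¹' G := by rw [hGS]; exact Or.inl rfl
    have hj : j ∈ v ⁻¹' G := by rw [hGS]; exact Or.inr rfl
    have hGC := hA G hG hi hj
    have : star i ∈ v ⁻¹' G := by rw [hGC]; exact h.mem _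
    exact hS i (Or.inl rfl) (hGS ▸ this)
  · rintro rfl G hG hi hj
    rcases (h.faces _).1 ⟨G, hG, rfl⟩ with hu | hS
    · refine (h.eq_iff hG (IsExposed.refl C)).2 (hu.trans ?_)
      exact (Set.eq_univ_of_forall h.mem).symm
    · exact absurd hj (hS i hi)

theorem CrossFaces.pairSequence_eq {C : Set (Euc n)} {v : Fin (2 * n) → Euc n}
    {star : Fin (2 * n) → Fin (2 * n)} (h : CrossFaces C v star)
    (hinv : Function.Involutive star) (hs : ∀ i, star i ≠ i) {a : Fin n → Fin (2 * n)}
    (hmono : StrictMono a) (ha : ∀ i, (∃ k, a k = i) ↔ i < star i) :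
    pairSequence C v = (List.finRange n).map fun k => (a k, star (a k)) := by
  classical
  have hmem : ∀ p, p ∈ pairSequence C v ↔ p ∈ (List.finRange n).map fun k => (a k, star (a k)) := by
    rintro ⟨i, j⟩
    simp only [pairSequence, List.mem_filter, List.mem_product, List.mem_finRange, true_and,
      and_self, decide_eq_true_eq, h.isAntipodal_iff hinv hs, List.mem_map, Prod.mk.injEq]
    constructor
    · rintro ⟨hij, rfl⟩
      obtain ⟨k, rfl⟩ := (ha i).2 hij
      exact ⟨k, rfl, rfl⟩
    · rintro ⟨k, rfl, rfl⟩
      exact ⟨(ha _).1 ⟨k, rfl⟩, rfl⟩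
  have h1 : (pairSequence C v).Pairwise fun p q => toLex p < toLex q := by
    refine List.Pairwise.filter _ ?_
    change List.Pairwise _ (List.flatMap _ _)
    rw [List.pairwise_flatMap]
    refine ⟨fun i _ => ?_, (List.pairwise_lt_finRange _).imp fun hij p hp q hq => ?_⟩
    · rw [List.pairwise_map]
      refine (List.pairwise_lt_finRange _).imp ?_
      exact fun hij => Prod.Lex.toLex_lt_toLex.2 (Or.inr ⟨rfl, hij⟩)
    · obtain ⟨x, -, rfl⟩ := List.mem_map.1 hp
      obtain ⟨y, -, rfl⟩ := List.mem_map.1 hq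
      exact Prod.Lex.toLex_lt_toLex.2 (Or.inl hij)
  have h2 : ((List.finRange n).map fun k => (a k, star (a k))).Pairwise
      fun p q => toLex p < toLex q := by
    rw [List.pairwise_map]
    exact (List.pairwise_lt_finRange _).imp fun hij =>
      Prod.Lex.toLex_lt_toLex.2 (Or.inl (hmono hij))
  have : Std.Antisymm fun p q : Fin (2 * n) × Fin (2 * n) => toLex p < toLex q :=
    ⟨fun _ _ h h' => absurd h' (lt_asymm h)⟩
  have : Std.Irrefl fun p q : Fin (2 * n) × Fin (2 * n) => toLex p < toLex q :=
    ⟨fun _ => lt_irrefl _⟩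
  exact h1.eq_of_mem_iff h2 hmem

/-- A star-closed initial segment of the labels consists of an initial segment of the pairs. -/
theorem exists_pairs_of_closed {star : Fin (2 * n) → Fin (2 * n)}
    (hinv : Function.Involutive star) (hs : ∀ i, star i ≠ i) {a : Fin n → Fin (2 * n)}
    (hmono : StrictMono a) (ha : ∀ i, (∃ k, a k = i) ↔ i < star i) {j : ℕ} (hj : j ≤ 2 * n)
    (hcl : ∀ i : Fin (2 * n), i.1 < j → (star i).1 < j) :
    ∃ c, j = 2 * c ∧ ∀ l : Fin (2 * n), l.1 < j ↔
      ∃ k : Fin n, k.1 < c ∧ (l = a k ∨ l = star (a k)) := by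
  classical
  obtain ⟨c, hcn, hc⟩ : ∃ c ≤ n, ∀ k : Fin n, (a k).1 < j ↔ k.1 < c := by
    have hex : ∃ c, ∀ h : c < n, j ≤ (a ⟨c, h⟩).1 := ⟨n, fun h => absurd h (lt_irrefl _)⟩
    refine ⟨Nat.find hex, Nat.find_min' hex fun h => absurd h (lt_irrefl _), fun k => ⟨fun hk => ?_,
      fun hk => ?_⟩⟩
    · by_contra! hle
      have h1 := Nat.find_spec hex (lt_of_le_of_lt hle k.2)
      have h2 : a ⟨Nat.find hex, lt_of_le_of_lt hle k.2⟩ ≤ a k := hmono.monotone hle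
      have h3 : (a ⟨Nat.find hex, lt_of_le_of_lt hle k.2⟩).1 ≤ (a k).1 := h2
      omega
    · have := Nat.find_min hex hk
      push Not at this
      obtain ⟨_, h⟩ := this
      exact h
  have hiff : ∀ l : Fin (2 * n), l.1 < j ↔ ∃ k : Fin n, k.1 < c ∧ (l = a k ∨ l = star (a k)) := by
    intro l
    constructor
    · intro hl
      rcases lt_or_gt_of_ne (hs l) with h1 | h1
      · obtain ⟨k, hk⟩ := (ha (star l)).2 (by rwa [hinv])
        exact ⟨k, (hc k).1 (by rw [hk]; exact hcl l hl), Or.inr (by rw [hk, hinv])⟩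
      · obtain ⟨k, hk⟩ := (ha l).2 h1
        exact ⟨k, (hc k).1 (by rwa [hk]), Or.inl hk.symm⟩
    · rintro ⟨k, hk, rfl | rfl⟩
      · exact (hc k).2 hk
      · exact hcl _ ((hc k).2 hk)
  refine ⟨c, ?_, hiff⟩
  have h1 : (Finset.univ.filter fun l : Fin (2 * n) => l.1 < j).card = j := by
    rw [Fin.card_filter_val_lt]; omega
  have h2 : (Finset.univ.filter fun k : Fin n => k.1 < c).card = c := by
    rw [Fin.card_filter_val_lt]; omega
  have h3 : (Finset.univ.filter fun l : Fin (2 * n) => l.1 < j) =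
      (Finset.univ.filter fun k : Fin n => k.1 < c).image a ∪
      (Finset.univ.filter fun k : Fin n => k.1 < c).image (star ∘ a) := by
    ext l
    simp only [Finset.mem_filter, Finset.mem_univ, true_and, hiff, Finset.mem_union,
      Finset.mem_image, Function.comp]
    constructor
    · rintro ⟨k, hk, rfl | rfl⟩
      · exact Or.inl ⟨k, hk, rfl⟩
      · exact Or.inr ⟨k, hk, rfl⟩
    · rintro (⟨k, hk, rfl⟩ | ⟨k, hk, rfl⟩)
      · exact ⟨k, hk, Or.inl rfl⟩
      · exact ⟨k, hk, Or.inr rfl⟩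
  have hdisj : Disjoint ((Finset.univ.filter fun k : Fin n => k.1 < c).image a)
      ((Finset.univ.filter fun k : Fin n => k.1 < c).image (star ∘ a)) := by
    rw [Finset.disjoint_left]
    intro l hl hl'
    obtain ⟨k, -, rfl⟩ := Finset.mem_image.1 hl
    obtain ⟨k', -, hk'⟩ := Finset.mem_image.1 hl'
    have h4 := (ha (a k)).1 ⟨k, rfl⟩
    have h5 := (ha (a k')).1 ⟨k', rfl⟩
    simp only [Function.comp] at hk'
    rw [← hk', hinv] at h4
    exact lt_asymm h4 h5
  rw [h3, Finset.card_union_of_disjoint hdisj, Finset.card_image_of_injective _ hmono.injective,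
    Finset.card_image_of_injective _ (hinv.injective.comp hmono.injective), h2] at h1
  omega

theorem CrossFaces.isGoodPairSequence_iff {C : Set (Euc n)} {v : Fin (2 * n) → Euc n}
    {star : Fin (2 * n) → Fin (2 * n)} (h : CrossFaces C v star)
    (hinv : Function.Involutive star) (hs : ∀ i, star i ≠ i) :
    IsGoodPairSequence n (pairSequence C v) ↔ IsGoodOrder star (id : Fin (2 * n) → Fin (2 * n)) := by
  obtain ⟨a, hmono, ha⟩ := exists_pairs hinv hs
  have hlab : ∀ k l, (∃ p ∈ (pairSequence C v).take k, l = p.1 ∨ l = p.2) ↔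
      ∃ k' : Fin n, k'.1 < k ∧ (l = a k' ∨ l = star (a k')) := by
    intro k l
    rw [h.pairSequence_eq hinv hs hmono ha, ← List.map_take]
    simp only [List.mem_map, List.mem_take_iff_getElem]
    constructor
    · rintro ⟨p, ⟨x, ⟨i, hi, rfl⟩, rfl⟩, hp⟩
      rw [List.getElem_finRange] at hp
      exact ⟨_, by simpa using (lt_min_iff.1 hi).1, hp⟩
    · rintro ⟨k', hk', hl⟩
      refine ⟨_, ⟨k', ⟨k'.1, by simpa using hk', ?_⟩, rfl⟩, hl⟩
      simp
  constructor
  · intro hg j hj0 hj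
    by_contra! hcon
    obtain ⟨c, rfl, hc⟩ := exists_pairs_of_closed hinv hs hmono ha hj.le fun i hi => by
      obtain ⟨k', hk', he⟩ := hcon i hi
      simp only [id] at he
      rwa [← he]
    refine hg c (by omega) (by omega) (Set.ext fun l => ?_)
    exact (hlab c l).trans (hc l).symm
  · intro hg k hk0 hk heq
    obtain ⟨i, hi, hi'⟩ := hg (2 * k) (by omega) (by omega)
    have h1 : i ∈ {l : Fin (2 * n) | l.1 < 2 * k} := hi
    rw [← heq] at h1
    obtain ⟨k', hk', h2⟩ := (hlab k i).1 h1
    have h3 : star i ∈ {l : Fin (2 * n) | l.1 < 2 * k} := by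
      rw [← heq]
      refine (hlab k _).2 ⟨k', hk', ?_⟩
      rcases h2 with rfl | rfl
      · exact Or.inr rfl
      · exact Or.inl (hinv _)
    exact hi' (star i) h3 rfl

/-- A nonempty set of labels can be listed first in a good order if it contains some label
without its antipode or is the set of all labels. -/
theorem exists_goodOrder {star : ι → ι} (hs : ∀ i, star i ≠ i)
    {R T : Finset ι} (hR : ∀ i ∈ R, star i ∈ R) (hTR : T ⊆ R) (hT : T.Nonempty)
    (hT' : T = R ∨ ∃ t ∈ T, star t ∉ T) :
    ∃ (m : ℕ) (a : Fin m → ι), Function.Injective a ∧ Set.range a = R ∧ IsGoodOrder star a ∧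
      ∃ r, 1 ≤ r ∧ r ≤ m ∧ {i | ∃ k : Fin m, k.1 < r ∧ a k = i} = T := by
  classical
  obtain ⟨t, ht, htT⟩ : ∃ t ∈ T, T = R ∨ star t ∉ T := by
    rcases hT' with h | ⟨t, ht, h⟩
    · obtain ⟨t, ht⟩ := hT
      exact ⟨t, ht, Or.inl h⟩
    · exact ⟨t, ht, Or.inr h⟩
  set A : List ι := t :: ((T.erase t).erase (star t)).toList with hA
  set B : List ι := ((R \ T).erase (star t)).toList with hB
  set L : List ι := (A ++ B) ++ [star t] with hL
  have hstar : star t ∈ R := hR t (hTR ht)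
  have hmemA : ∀ i, i ∈ A ↔ i ∈ T ∧ i ≠ star t := by
    intro i
    simp only [hA, List.mem_cons, Finset.mem_toList, Finset.mem_erase]
    constructor
    · rintro (rfl | h)
      · exact ⟨ht, (hs _).symm⟩
      · exact ⟨h.2.2, h.1⟩
    · rintro ⟨h1, h2⟩
      by_cases h : i = t
      · exact Or.inl h
      · exact Or.inr ⟨h2, h, h1⟩
  have hmemB : ∀ i, i ∈ B ↔ (i ∈ R ∧ i ∉ T) ∧ i ≠ star t := by
    intro i
    simp only [hB, Finset.mem_toList, Finset.mem_erase, Finset.mem_sdiff]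
    tauto
  have hmemL : ∀ i, i ∈ L ↔ i ∈ R := by
    intro i
    simp only [hL, List.mem_append, hmemA, hmemB, List.mem_singleton]
    constructor
    · rintro ((h | h) | h)
      · exact hTR h.1
      · exact h.1.1
      · exact h ▸ hstar
    · intro h
      tauto
  have hnodA : A.Nodup := by
    rw [hA, List.nodup_cons]
    exact ⟨by simp, Finset.nodup_toList _⟩
  have hnodAB : (A ++ B).Nodup := by
    rw [List.nodup_append']
    refine ⟨hnodA, Finset.nodup_toList _, fun i hi hi' => ?_⟩
    exact ((hmemB i).1 hi').1.2 ((hmemA i).1 hi).1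
  have hnod : L.Nodup := by
    rw [hL, List.nodup_append']
    refine ⟨hnodAB, List.nodup_singleton _, fun i hi hi' => ?_⟩
    rw [List.mem_singleton] at hi'
    rw [List.mem_append, hmemA, hmemB] at hi
    tauto
  have hlen : L.length = (A ++ B).length + 1 := by simp [hL]; omega
  have htake : ∀ r i, (∃ k : Fin L.length, k.1 < r ∧ L.get k = i) ↔ i ∈ L.take r := by
    intro r i
    rw [List.mem_take_iff_getElem]
    constructor
    · rintro ⟨k, hk, rfl⟩
      exact ⟨k.1, lt_min hk k.2, rfl⟩
    · rintro ⟨k, hk, rfl⟩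
      exact ⟨⟨k, (lt_min_iff.1 hk).2⟩, (lt_min_iff.1 hk).1, rfl⟩
  refine ⟨L.length, L.get, List.nodup_iff_injective_get.1 hnod, ?_, fun j hj0 hj => ?_, ?_⟩
  · ext i
    rw [Set.mem_range, Finset.mem_coe, ← hmemL, List.mem_iff_get]
  · refine ⟨⟨0, by omega⟩, hj0, fun k' hk' he => ?_⟩
    have h1 : L.get k' ∈ (A ++ B) := by
      have h2 : L.get k' ∈ L.take (A ++ B).length := (htake _ _).1 ⟨k', by omega, rfl⟩
      have h3 : L.take (A ++ B).length = A ++ B := by rw [hL, List.take_left' rfl]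
      rwa [h3] at h2
    have h0 : L.get ⟨0, by omega⟩ = t := rfl
    rw [he, h0, List.mem_append, hmemA, hmemB] at h1
    tauto
  · rcases htT with h | h
    · refine ⟨L.length, by omega, le_rfl, Set.ext fun i => ?_⟩
      rw [Set.mem_ofPred_eq, htake, List.take_length, hmemL, Finset.mem_coe, h]
    · refine ⟨A.length, by simp [hA], by simp [hL], Set.ext fun i => ?_⟩
      rw [Set.mem_ofPred_eq, htake, hL, List.append_assoc, List.take_left' rfl, hmemA,
        Finset.mem_coe]
      exact ⟨fun h => h.1, fun hi => ⟨hi, fun he => h (he ▸ hi)⟩⟩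

/-- The recursive condition on a shelling in terms of labels. -/
theorem isGoodOrder_iff_forall {star : ι → ι} (hinv : Function.Involutive star)
    (hs : ∀ i, star i ≠ i) {m : ℕ} {a : Fin m → ι} (ha : Function.Injective a) (hm : 2 < m) :
    IsGoodOrder star a ↔ ∀ j : Fin m, 0 < j.1 →
      (∃ i : Fin m, i < j ∧ a i ≠ star (a j)) ∧
      ((∀ i : Fin m, i ≠ j → a i ≠ star (a j) → i < j) ∨
        ∃ i : Fin m, i < j ∧ a i ≠ star (a j) ∧ ∀ i' : Fin m, i' < j → a i' ≠ star (a i)) := by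
  constructor
  · intro hg j hj
    by_cases hjs : ∃ i : Fin m, i < j ∧ a i = star (a j)
    · obtain ⟨i, hij, hi⟩ := hjs
      have hij' : i.1 < j.1 := hij
      by_cases hjm : j.1 + 1 < m
      · obtain ⟨k, hk, hk'⟩ := hg (j.1 + 1) (by omega) hjm
        have hkj : k ≠ j := by
          rintro rfl
          exact hk' i (by omega) hi
        have hklt : k < j := lt_of_le_of_ne (Nat.lt_succ_iff.1 hk) hkj
        have hne : a k ≠ star (a j) := fun h => hk' j (by omega) (by rw [h, hinv])
        refine ⟨⟨k, hklt, hne⟩, Or.inr ⟨k, hklt, hne, fun i' hi' => hk' i' ?_⟩⟩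
        have : i'.1 < j.1 := hi'
        omega
      · refine ⟨?_, Or.inl fun i' hne _ => ?_⟩
        · obtain ⟨i', hi'j, hi'⟩ : ∃ i' : Fin m, i' < j ∧ i' ≠ i := by
            by_cases h0 : i.1 = 0
            · refine ⟨⟨1, by omega⟩, Fin.mk_lt_of_lt_val (by omega), fun h => ?_⟩
              rw [← h] at h0
              exact one_ne_zero h0
            · refine ⟨⟨0, by omega⟩, Fin.mk_lt_of_lt_val (by omega), fun h => h0 ?_⟩
              rw [← h]
          exact ⟨i', hi'j, fun h => hi' (ha (h.trans hi.symm))⟩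
        · have h1 := i'.2
          have h2 : i'.1 ≠ j.1 := fun h => hne (Fin.ext h)
          exact Fin.lt_def.2 (by omega)
    · push Not at hjs
      obtain ⟨k, hk, hk'⟩ := hg j.1 hj j.2
      exact ⟨⟨k, hk, hjs k hk⟩, Or.inr ⟨k, hk, hjs k hk, fun i' hi' => hk' i' hi'⟩⟩
  · intro h j hj0 hjm
    by_contra! hcl
    obtain ⟨i, hi, hia⟩ := hcl ⟨j - 1, by omega⟩ (show j - 1 < j by omega)
    have hne : i.1 ≠ j - 1 := fun h => by
      have : i = ⟨j - 1, by omega⟩ := Fin.ext h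
      rw [this] at hia
      exact hs _ hia.symm
    obtain ⟨-, h1 | ⟨k, hk, hk1, hk2⟩⟩ := h ⟨j - 1, by omega⟩ (show 0 < j - 1 by omega)
    · have h2 := h1 ⟨j, hjm⟩ (fun he => by have := congrArg Fin.val he; simp only at this; omega)
        (fun he => by
          have := congrArg Fin.val (ha (he.trans hia.symm))
          simp only at this; omega)
      have h3 : j < j - 1 := h2
      omega
    · have hk3 : k.1 < j - 1 := hk
      obtain ⟨k', hk', hka⟩ := hcl k (by omega)
      by_cases hlt : k'.1 < j - 1
      · exact hk2 k' hlt hka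
      · have hk4 : k' = ⟨j - 1, by omega⟩ := Fin.ext (by simp only; omega)
        rw [hk4] at hka
        exact hk1 (by rw [hka, hinv])

end Orders

end CubeShelling

namespace CubeShelling

section Shellings

variable {n : ℕ} {ι : Type*}

/-- The facets of `P` are labelled so that the sets of labels of the facets containing a given
face are the sets without antipodal labels and (for the empty face) the set of all labels. -/
structure CubeFaces (P : Set (Euc n)) (F : ι → Set (Euc n)) (star : ι → ι) : Prop where
  isPolytope : IsPolytope P
  isExposed : ∀ i, IsExposed ℝ P (F i)
  subset_iff : ∀ G H, IsExposed ℝ P G → IsExposed ℝ P H →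
    (G ⊆ H ↔ {i | H ⊆ F i} ⊆ {i | G ⊆ F i})
  faces : ∀ S : Set ι, (∃ H, IsExposed ℝ P H ∧ {i | H ⊆ F i} = S) ↔
    (S = Set.univ ∨ AntipodeFree star S)

theorem CrossFaces.cubeFaces [Finite ι] {P C : Set (Euc n)} {v : ι → Euc n} {star : ι → ι}
    (h : CrossFaces C v star) (hP : IsPolytope P) (Φ : Face C ≃o (Face P)ᵒᵈ)
    {F : ι → Set (Euc n)}
    (hF : ∀ i, ∃ hx : IsExposed ℝ C {v i}, (OrderDual.ofDual (Φ ⟨{v i}, hx⟩)).val = F i) :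
    CubeFaces P F star := by
  have key : ∀ G : Face P, {i | G.1 ⊆ F i} = v ⁻¹' (Φ.symm (OrderDual.toDual G)).1 := by
    intro G
    ext i
    obtain ⟨hx, hi⟩ := hF i
    have h1 : (⟨{v i}, hx⟩ : Face C) ≤ Φ.symm (OrderDual.toDual G) ↔
        Φ ⟨{v i}, hx⟩ ≤ OrderDual.toDual G := by
      rw [← Φ.le_iff_le, Φ.apply_symm_apply]
    have h2 : Φ ⟨{v i}, hx⟩ ≤ OrderDual.toDual G ↔ G.1 ⊆ F i := by
      rw [← hi]; rfl
    have h3 : (⟨{v i}, hx⟩ : Face C) ≤ Φ.symm (OrderDual.toDual G) ↔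
        v i ∈ (Φ.symm (OrderDual.toDual G)).1 := Set.singleton_subset_iff
    exact (h2.symm.trans h1.symm).trans h3
  refine ⟨hP, fun i => ?_, fun G H hG hH => ?_, fun S => ?_⟩
  · obtain ⟨hx, hi⟩ := hF i
    rw [← hi]
    exact (OrderDual.ofDual (Φ ⟨{v i}, hx⟩)).2
  · have h1 := key ⟨G, hG⟩
    have h2 := key ⟨H, hH⟩
    simp only at h1 h2
    rw [h1, h2, ← h.subset_iff (Subtype.prop _) (Subtype.prop _)]
    change (⟨G, hG⟩ : Face P) ≤ ⟨H, hH⟩ ↔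
      Φ.symm (OrderDual.toDual ⟨H, hH⟩) ≤ Φ.symm (OrderDual.toDual ⟨G, hG⟩)
    rw [Φ.symm.le_iff_le]
    rfl
  · rw [← h.faces]
    constructor
    · rintro ⟨H, hH, rfl⟩
      exact ⟨_, Subtype.prop _, (key ⟨H, hH⟩).symm⟩
    · rintro ⟨G, hG, rfl⟩
      refine ⟨_, (OrderDual.ofDual (Φ ⟨G, hG⟩)).2, ?_⟩
      rw [key]
      change v ⁻¹' (Φ.symm (Φ ⟨G, hG⟩)).1 = _
      rw [Φ.symm_apply_apply]

/-- The face with a given set of labels. -/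
def cubeFace (P : Set (Euc n)) (F : ι → Set (Euc n)) (I : Set ι) : Set (Euc n) :=
  P ∩ ⋂ i ∈ I, F i

theorem cubeFace_insert (P : Set (Euc n)) (F : ι → Set (Euc n)) (a : ι) (I : Set ι) :
    cubeFace P F (insert a I) = cubeFace P F I ∩ F a := by
  ext x
  simp only [cubeFace, Set.mem_inter_iff, Set.mem_iInter, Set.mem_insert_iff, forall_eq_or_imp]
  tauto

open Classical in
/-- The labels that can be added to a set of labels without antipodal pairs. -/
noncomputable def freeLabels [Fintype ι] (star : ι → ι) (I : Set ι) : Finset ι :=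
  Finset.univ.filter fun a => a ∉ I ∧ star a ∉ I

theorem mem_freeLabels [Fintype ι] {star : ι → ι} {I : Set ι} {a : ι} :
    a ∈ freeLabels star I ↔ a ∉ I ∧ star a ∉ I := by simp [freeLabels]

theorem star_mem_freeLabels [Fintype ι] {star : ι → ι} (hinv : Function.Involutive star)
    {I : Set ι} {a : ι} (ha : a ∈ freeLabels star I) : star a ∈ freeLabels star I := by
  rw [mem_freeLabels] at *
  rw [hinv]
  exact ha.symm

theorem mem_freeLabels_insert [Fintype ι] {star : ι → ι} (hinv : Function.Involutive star)
    {I : Set ι} {a b : ι} : b ∈ freeLabels star (insert a I) ↔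
      b ∈ freeLabels star I ∧ b ≠ a ∧ b ≠ star a := by
  have : star b = a ↔ b = star a := ⟨fun h => by rw [← h, hinv], fun h => by rw [h, hinv]⟩
  simp only [mem_freeLabels, Set.mem_insert_iff, not_or, this]
  tauto

theorem card_freeLabels_insert [Fintype ι] {star : ι → ι} (hinv : Function.Involutive star)
    (hs : ∀ i, star i ≠ i) {I : Set ι} {a : ι} (ha : a ∈ freeLabels star I) :
    (freeLabels star (insert a I)).card + 2 = (freeLabels star I).card := by
  classical
  have h1 : freeLabels star (insert a I) = ((freeLabels star I).erase a).erase (star a) := by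
    ext b
    rw [mem_freeLabels_insert hinv, Finset.mem_erase, Finset.mem_erase]
    tauto
  have h2 : star a ∈ (freeLabels star I).erase a :=
    Finset.mem_erase.2 ⟨hs a, star_mem_freeLabels hinv ha⟩
  rw [h1, ← Finset.card_erase_add_one ha, ← Finset.card_erase_add_one h2]

theorem antipodeFree_insert [Fintype ι] {star : ι → ι} (hinv : Function.Involutive star)
    (hs : ∀ i, star i ≠ i) {I : Set ι} (hI : AntipodeFree star I) {a : ι}
    (ha : a ∈ freeLabels star I) : AntipodeFree star (insert a I) := by
  rw [mem_freeLabels] at ha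
  rintro i (rfl | hi) (h | h)
  · exact hs _ h
  · exact ha.2 h
  · exact ha.2 (by rwa [← h, hinv])
  · exact hI i hi h

namespace CubeFaces

variable {P : Set (Euc n)} {F : ι → Set (Euc n)} {star : ι → ι}

theorem eq_iff (h : CubeFaces P F star) {G H : Set (Euc n)} (hG : IsExposed ℝ P G)
    (hH : IsExposed ℝ P H) : G = H ↔ {i | G ⊆ F i} = {i | H ⊆ F i} := by
  rw [Set.Subset.antisymm_iff, Set.Subset.antisymm_iff, h.subset_iff G H hG hH,
    h.subset_iff H G hH hG, and_comm]

theorem isExposed_cubeFace [Finite ι] (h : CubeFaces P F star) (I : Set ι) :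
    IsExposed ℝ P (cubeFace P F I) := by
  induction I, I.toFinite using Set.Finite.induction_on with
  | empty => simpa [cubeFace] using IsExposed.refl P
  | insert _ _ ih => rw [cubeFace_insert]; exact ih.inter (h.isExposed _)

theorem cubeFace_labels [Finite ι] (h : CubeFaces P F star) {G : Set (Euc n)}
    (hG : IsExposed ℝ P G) : cubeFace P F {i | G ⊆ F i} = G := by
  apply Set.Subset.antisymm
  · rw [h.subset_iff _ _ (h.isExposed_cubeFace _) hG]
    intro i hi x hx
    exact Set.mem_iInter₂.1 hx.2 i hi
  · exact fun x hx => ⟨hG.subset hx, Set.mem_iInter₂.2 fun i hi => hi hx⟩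

theorem labels_cubeFace [Finite ι] (h : CubeFaces P F star) {I : Set ι}
    (hI : AntipodeFree star I) : {i | cubeFace P F I ⊆ F i} = I := by
  obtain ⟨H, hH, rfl⟩ := (h.faces I).2 (Or.inr hI)
  rw [h.cubeFace_labels hH]

theorem cubeFace_eq_empty [Finite ι] (h : CubeFaces P F star) {I : Set ι} {a : ι} (ha : a ∈ I)
    (ha' : star a ∈ I) : cubeFace P F I = ∅ := by
  rw [h.eq_iff (h.isExposed_cubeFace I) isExposed_empty]
  have hsub : ∀ i ∈ I, i ∈ {i | cubeFace P F I ⊆ F i} := fun i hi x hx =>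
    Set.mem_iInter₂.1 hx.2 i hi
  rcases (h.faces _).1 ⟨_, h.isExposed_cubeFace I, rfl⟩ with h1 | h1
  · rw [h1]
    exact (Set.eq_univ_of_forall fun i => Set.empty_subset _).symm
  · exact absurd (hsub _ ha') (h1 a (hsub _ ha))

theorem cubeFace_subset_iff [Finite ι] (h : CubeFaces P F star) {I J : Set ι}
    (hI : AntipodeFree star I) (hJ : AntipodeFree star J) :
    cubeFace P F I ⊆ cubeFace P F J ↔ J ⊆ I := by
  rw [h.subset_iff _ _ (h.isExposed_cubeFace I) (h.isExposed_cubeFace J), h.labels_cubeFace hI,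
    h.labels_cubeFace hJ]

theorem cubeFace_nonempty [Finite ι] (h : CubeFaces P F star)
    {I : Set ι} (hI : AntipodeFree star I) {a : ι} (ha : a ∉ I) : (cubeFace P F I).Nonempty := by
  rw [Set.nonempty_iff_ne_empty]
  intro h0
  have h1 := h.labels_cubeFace hI
  rw [h0] at h1
  exact ha (h1 ▸ Set.empty_subset (F a))

theorem facets_cubeFace [Fintype ι] (h : CubeFaces P F star) (hinv : Function.Involutive star)
    (hs : ∀ i, star i ≠ i) {I : Set ι} (hI : AntipodeFree star I)
    (hne : (freeLabels star I).Nonempty) :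
    facets (cubeFace P F I) = (fun a => cubeFace P F (insert a I)) '' (freeLabels star I) := by
  have hpoly := h.isPolytope.face (h.isExposed_cubeFace I)
  have hproper : ∀ a ∈ freeLabels star I, IsExposed ℝ (cubeFace P F I) (cubeFace P F (insert a I)) ∧
      cubeFace P F (insert a I) ≠ cubeFace P F I := by
    intro a ha
    have hsub : cubeFace P F (insert a I) ⊆ cubeFace P F I := by
      rw [cubeFace_insert]; exact Set.inter_subset_left
    refine ⟨(h.isExposed_cubeFace _).mono (h.isExposed_cubeFace I).subset hsub, fun he => ?_⟩
    have := (h.cubeFace_subset_iff hI (antipodeFree_insert hinv hs hI ha)).1 he.ge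
    exact (mem_freeLabels.1 ha).1 (this (Set.mem_insert _ _))
  have hle : ∀ G, IsExposed ℝ (cubeFace P F I) G → G ≠ cubeFace P F I →
      ∃ a ∈ freeLabels star I, G ⊆ cubeFace P F (insert a I) := by
    intro G hG hGne
    have hGP := h.isPolytope.face_of_face (h.isExposed_cubeFace I) hG
    rcases (h.faces _).1 ⟨G, hGP, rfl⟩ with h1 | h1
    · obtain ⟨a, ha⟩ := hne
      refine ⟨a, ha, ?_⟩
      rw [h.subset_iff _ _ hGP (h.isExposed_cubeFace _), h1]
      exact Set.subset_univ _
    · have hIG : I ⊆ {i | G ⊆ F i} := by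
        have := (h.subset_iff _ _ hGP (h.isExposed_cubeFace I)).1 hG.subset
        rwa [h.labels_cubeFace hI] at this
      obtain ⟨a, ha, haI⟩ : ∃ a ∈ {i | G ⊆ F i}, a ∉ I := by
        by_contra! hcon
        refine hGne ?_
        rw [← h.cubeFace_labels hGP, Set.Subset.antisymm hcon hIG]
      refine ⟨a, mem_freeLabels.2 ⟨haI, fun hs' => h1 a ha (hIG hs')⟩, ?_⟩
      rw [cubeFace_insert]
      exact Set.subset_inter hG.subset ha
  ext G
  constructor
  · rintro ⟨⟨hG, hGne⟩, hmax⟩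
    obtain ⟨a, ha, hGa⟩ := hle G hG hGne
    exact ⟨a, ha, (hmax (hproper a ha) hGa).antisymm hGa⟩
  · rintro ⟨a, ha, rfl⟩
    refine ⟨hproper a ha, fun G hG hGa => ?_⟩
    obtain ⟨b, hb, hGb⟩ := hle G hG.1 hG.2
    have h1 := (h.cubeFace_subset_iff (antipodeFree_insert hinv hs hI ha)
      (antipodeFree_insert hinv hs hI hb)).1 (hGa.trans hGb)
    rcases h1 (Set.mem_insert _ _) with h2 | h2
    · rwa [← h2]
    · exact absurd h2 (mem_freeLabels.1 hb).1

theorem injOn_cubeFace_insert [Fintype ι] (h : CubeFaces P F star)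
    (hinv : Function.Involutive star) (hs : ∀ i, star i ≠ i) {I : Set ι}
    (hI : AntipodeFree star I) {a b : ι} (ha : a ∈ freeLabels star I)
    (hb : b ∈ freeLabels star I)
    (hab : cubeFace P F (insert a I) ⊆ cubeFace P F (insert b I)) : a = b := by
  have h1 := (h.cubeFace_subset_iff (antipodeFree_insert hinv hs hI ha)
    (antipodeFree_insert hinv hs hI hb)).1 hab
  rcases h1 (Set.mem_insert _ _) with h2 | h2
  · exact h2.symm
  · exact absurd h2 (mem_freeLabels.1 hb).1

theorem isFacetOrdering_iff [Fintype ι] (h : CubeFaces P F star)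
    (hinv : Function.Involutive star) (hs : ∀ i, star i ≠ i) {I : Set ι}
    (hI : AntipodeFree star I) (hne : (freeLabels star I).Nonempty) {m : ℕ}
    (G : Fin m → Set (Euc n)) :
    IsFacetOrdering (cubeFace P F I) G ↔ ∃ a : Fin m → ι, Function.Injective a ∧
      Set.range a = freeLabels star I ∧ ∀ k, G k = cubeFace P F (insert (a k) I) := by
  rw [IsFacetOrdering, h.facets_cubeFace hinv hs hI hne]
  constructor
  · rintro ⟨hinj, hr⟩
    have h1 : ∀ k, ∃ a ∈ freeLabels star I, cubeFace P F (insert a I) = G k := fun k => by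
      have : G k ∈ Set.range G := Set.mem_range_self k
      rw [hr] at this
      exact this
    choose a ha hak using h1
    refine ⟨a, fun i j hij => hinj (by rw [← hak, ← hak, hij]), ?_, fun k => (hak k).symm⟩
    apply Set.Subset.antisymm
    · rintro _ ⟨k, rfl⟩; exact ha k
    · intro b hb
      have : cubeFace P F (insert b I) ∈ Set.range G := by rw [hr]; exact ⟨b, hb, rfl⟩
      obtain ⟨k, hk⟩ := this
      refine ⟨k, h.injOn_cubeFace_insert hinv hs hI (ha k) hb ?_⟩
      rw [hak, hk]
  · rintro ⟨a, hinj, hr, hG⟩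
    have ha : ∀ k, a k ∈ freeLabels star I := fun k => by
      rw [← Finset.mem_coe, ← hr]; exact Set.mem_range_self k
    obtain rfl : G = fun k => cubeFace P F (insert (a k) I) := funext hG
    refine ⟨fun i j hij => hinj (h.injOn_cubeFace_insert hinv hs hI (ha i) (ha j) hij.le), ?_⟩
    rw [← hr, ← Set.range_comp]
    rfl

/-- Unions of facets of a face are determined by the labels of these facets. -/
theorem biUnion_cubeFace_eq_iff [Fintype ι] (h : CubeFaces P F star)
    (hinv : Function.Involutive star) (hs : ∀ i, star i ≠ i) {I : Set ι}
    (hI : AntipodeFree star I) {A B : Set ι} (hA : A ⊆ freeLabels star I)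
    (hB : B ⊆ freeLabels star I) :
    (⋃ x ∈ A, cubeFace P F (insert x I)) = (⋃ x ∈ B, cubeFace P F (insert x I)) ↔ A = B := by
  have key : ∀ {A B : Set ι}, A ⊆ freeLabels star I → B ⊆ freeLabels star I →
      (⋃ x ∈ A, cubeFace P F (insert x I)) ⊆ (⋃ x ∈ B, cubeFace P F (insert x I)) → A ⊆ B := by
    intro A B hA hB hAB a ha
    have haf := hA ha
    have hne : (cubeFace P F (insert a I)).Nonempty := by
      refine h.cubeFace_nonempty (antipodeFree_insert hinv hs hI haf) (a := star a) ?_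
      rintro (h1 | h1)
      · exact hs a h1
      · exact (mem_freeLabels.1 haf).2 h1
    obtain ⟨x, hx, hmin⟩ := h.isPolytope.exists_mem_forall_face (h.isExposed_cubeFace _) hne
    obtain ⟨b, hb, hxb⟩ := Set.mem_iUnion₂.1 (hAB (Set.mem_iUnion₂.2 ⟨a, ha, hx⟩))
    have := h.injOn_cubeFace_insert hinv hs hI haf (hB hb) (hmin _ (h.isExposed_cubeFace _) hxb)
    rwa [this]
  constructor
  · intro he
    exact (key hA hB he.le).antisymm (key hB hA he.ge)
  · rintro rfl; rfl

/-- The shellings of the faces of a cube. -/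
theorem isShelling_cubeFace_iff [Fintype ι] (h : CubeFaces P F star)
    (hinv : Function.Involutive star) (hs : ∀ i, star i ≠ i) (d : ℕ) :
    ∀ {I : Set ι}, AntipodeFree star I → (freeLabels star I).card = 2 * (d + 1) →
      ∀ {m : ℕ} (G : Fin m → Set (Euc n)),
    (IsShelling (d + 1) (cubeFace P F I) m G ↔ ∃ a : Fin m → ι, Function.Injective a ∧
      Set.range a = freeLabels star I ∧ (∀ k, G k = cubeFace P F (insert (a k) I)) ∧
      IsGoodOrder star a) := by
  have hcard : ∀ {I : Set ι} {m : ℕ} {a : Fin m → ι}, Function.Injective a →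
      Set.range a = freeLabels star I → m = (freeLabels star I).card := by
    classical
    intro I m a hinj hr
    have h1 : Finset.univ.image a = freeLabels star I := by
      apply Finset.coe_injective
      rw [Finset.coe_image, Finset.coe_univ, Set.image_univ, hr]
    rw [← h1, Finset.card_image_of_injective _ hinj, Finset.card_univ, Fintype.card_fin]
  induction d with
  | zero =>
    intro I hI hc m G
    have hne : (freeLabels star I).Nonempty := Finset.card_pos.1 (by omega)
    rw [zero_add, IsShelling, h.isFacetOrdering_iff hinv hs hI hne]
    refine exists_congr fun a => ⟨fun ⟨h1, h2, h3⟩ => ⟨h1, h2, h3, fun j hj0 hj => ?_⟩,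
      fun ⟨h1, h2, h3, _⟩ => ⟨h1, h2, h3⟩⟩
    have hm := hcard h1 h2
    refine ⟨⟨0, by omega⟩, hj0, fun k' hk' he => ?_⟩
    have : k' = ⟨0, by omega⟩ := Fin.ext (by simp only; omega)
    rw [this] at he
    exact hs _ he.symm
  | succ d ih =>
    intro I hI hc m G
    have hne : (freeLabels star I).Nonempty := Finset.card_pos.1 (by omega)
    rw [IsShelling, h.isFacetOrdering_iff hinv hs hI hne]
    have hsplit : ∀ (a : Fin m → ι), Set.range a = freeLabels star I → ∀ j : Fin m,
        a j ∈ freeLabels star I ∧ AntipodeFree star (insert (a j) I) ∧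
        (freeLabels star (insert (a j) I)).card = 2 * (d + 1) := by
      intro a hr j
      have h1 : a j ∈ freeLabels star I := by
        rw [← Finset.mem_coe, ← hr]; exact Set.mem_range_self j
      have h2 := card_freeLabels_insert hinv hs h1
      exact ⟨h1, antipodeFree_insert hinv hs hI h1, by omega⟩
    have hunion : ∀ (a : Fin m → ι), Function.Injective a → Set.range a = freeLabels star I →
        ∀ (j : Fin m) (k : ℕ) (b : Fin k → ι) (r : ℕ),
        Set.range b = freeLabels star (insert (a j) I) →
        ((cubeFace P F (insert (a j) I) ∩ ⋃ (i : Fin m) (_ : i < j), cubeFace P F (insert (a i) I)) =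
          (⋃ (i : Fin k) (_ : i.val < r), cubeFace P F (insert (b i) (insert (a j) I))) ↔
        {x | ∃ i : Fin m, (i < j ∧ a i ≠ star (a j)) ∧ a i = x} =
          {x | ∃ l : Fin k, l.1 < r ∧ b l = x}) := by
      intro a hinj hr j k b r hb
      obtain ⟨haj, hAF, -⟩ := hsplit a hr j
      rw [← h.biUnion_cubeFace_eq_iff hinv hs hAF]
      · refine iff_of_eq (congrArg₂ _ ?_ ?_)
        · ext y
          simp only [Set.mem_inter_iff, Set.mem_iUnion, exists_prop, Set.mem_ofPred_eq]
          constructor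
          · rintro ⟨hy, i, hij, hyi⟩
            have hmem : y ∈ cubeFace P F (insert (a i) (insert (a j) I)) := by
              rw [cubeFace_insert]
              rw [cubeFace_insert] at hyi
              exact ⟨hy, hyi.2⟩
            refine ⟨a i, ⟨i, ⟨hij, fun he => ?_⟩, rfl⟩, hmem⟩
            rw [h.cubeFace_eq_empty (a := a j) (Set.mem_insert_of_mem _ (Set.mem_insert _ _))
              (he ▸ Set.mem_insert _ _)] at hmem
            exact hmem
          · rintro ⟨_, ⟨i, ⟨hij, -⟩, rfl⟩, hy⟩
            rw [Set.insert_comm, cubeFace_insert] at hy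
            refine ⟨?_, i, hij, hy.1⟩
            rw [cubeFace_insert] at hy ⊢
            exact ⟨hy.1.1, hy.2⟩
        · ext y
          simp only [Set.mem_iUnion, exists_prop, Set.mem_ofPred_eq]
          constructor
          · rintro ⟨l, hl, hy⟩
            exact ⟨b l, ⟨l, hl, rfl⟩, hy⟩
          · rintro ⟨_, ⟨l, hl, rfl⟩, hy⟩
            exact ⟨l, hl, hy⟩
      · rintro _ ⟨i, ⟨hij, hne'⟩, rfl⟩
        exact (mem_freeLabels_insert hinv).2 ⟨(hsplit a hr i).1, fun he => hij.ne (hinj he), hne'⟩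
      · rintro _ ⟨l, -, rfl⟩
        rw [← hb]
        exact Set.mem_range_self l
    constructor
    · rintro ⟨⟨a, hinj, hr, hG⟩, -, hsh⟩
      obtain rfl : G = fun k => cubeFace P F (insert (a k) I) := funext hG
      have hm := hcard hinj hr
      refine ⟨a, hinj, hr, hG, (isGoodOrder_iff_forall hinv hs hinj (by omega)).2 fun j hj => ?_⟩
      obtain ⟨haj, hAF, hc'⟩ := hsplit a hr j
      obtain ⟨k, G', hG', r, hr1, hrk, hU⟩ := hsh j hj
      obtain ⟨b, hbinj, hbr, hb, hbg⟩ := (ih hAF hc' G').1 hG'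
      obtain rfl : G' = fun l => cubeFace P F (insert (b l) (insert (a j) I)) := funext hb
      have hS := (hunion a hinj hr j k b r hbr).1 hU
      have hS' : ∀ l : Fin k, l.1 < r → ∃ i : Fin m, (i < j ∧ a i ≠ star (a j)) ∧ a i = b l := by
        intro l hl
        have : b l ∈ {x | ∃ l : Fin k, l.1 < r ∧ b l = x} := ⟨l, hl, rfl⟩
        rw [← hS] at this
        exact this
      have hS'' : ∀ i : Fin m, i < j → a i ≠ star (a j) → ∃ l : Fin k, l.1 < r ∧ b l = a i := by
        intro i hi hi'
        have : a i ∈ {x | ∃ i : Fin m, (i < j ∧ a i ≠ star (a j)) ∧ a i = x} := ⟨i, ⟨hi, hi'⟩, rfl⟩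
        rw [hS] at this
        exact this
      constructor
      · obtain ⟨i, hi, -⟩ := hS' ⟨0, by omega⟩ (by simp only; omega)
        exact ⟨i, hi⟩
      · rcases hrk.lt_or_eq with hlt | rfl
        · right
          obtain ⟨l, hl, hl'⟩ := hbg r (by omega) hlt
          obtain ⟨i, ⟨hij, hi⟩, hib⟩ := hS' l hl
          refine ⟨i, hij, hi, fun i' hi'j he => ?_⟩
          obtain ⟨l', hl'r, hl'b⟩ := hS'' i' hi'j fun he' =>
            hij.ne (hinj (hinv.injective (he.symm.trans he')))
          exact hl' l' hl'r (by rw [hl'b, he, hib])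
        · left
          intro i hij hi
          have hmem : a i ∈ Set.range b := by
            rw [hbr]
            exact (mem_freeLabels_insert hinv).2
              ⟨(hsplit a hr i).1, fun he => hij (hinj he), hi⟩
          obtain ⟨l, hl⟩ := hmem
          obtain ⟨i', ⟨hi'j, -⟩, hi'⟩ := hS' l l.2
          rwa [hinj (hl.symm.trans hi'.symm)]
    · rintro ⟨a, hinj, hr, hG, hg⟩
      obtain rfl : G = fun k => cubeFace P F (insert (a k) I) := funext hG
      have hm := hcard hinj hr
      refine ⟨⟨a, hinj, hr, hG⟩, fun j _ => ?_, fun j hj => ?_⟩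
      · obtain ⟨haj, hAF, hc'⟩ := hsplit a hr j
        obtain ⟨k, b, hbinj, hbr, hbg, -⟩ := exists_goodOrder hs
          (fun i hi => star_mem_freeLabels hinv hi) (Finset.Subset.refl _)
          (Finset.card_pos.1 (by omega : 0 < (freeLabels star (insert (a j) I)).card)) (Or.inl rfl)
        exact ⟨k, _, (ih hAF hc' _).2 ⟨b, hbinj, hbr, fun _ => rfl, hbg⟩⟩
      · classical
        obtain ⟨haj, hAF, hc'⟩ := hsplit a hr j
        obtain ⟨⟨i₀, hi₀, hi₀'⟩, hor⟩ :=
          (isGoodOrder_iff_forall hinv hs hinj (by omega)).1 hg j hj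
        set R := freeLabels star (insert (a j) I) with hR
        set T := R.filter fun x => ∃ i : Fin m, i < j ∧ a i = x with hT
        have hmemT : ∀ i : Fin m, a i ∈ T ↔ i < j ∧ a i ≠ star (a j) := by
          intro i
          rw [hT, Finset.mem_filter, hR, mem_freeLabels_insert hinv]
          constructor
          · rintro ⟨⟨-, -, h1⟩, i', h2, h3⟩
            exact ⟨hinj h3 ▸ h2, h1⟩
          · rintro ⟨h1, h2⟩
            exact ⟨⟨(hsplit a hr i).1, fun he => h1.ne (hinj he), h2⟩, i, h1, rfl⟩
        have hTeq : {x | ∃ i : Fin m, (i < j ∧ a i ≠ star (a j)) ∧ a i = x} = T := by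
          ext x
          constructor
          · rintro ⟨i, hi, rfl⟩
            exact (hmemT i).2 hi
          · intro hx
            obtain ⟨i, -, rfl⟩ := (Finset.mem_filter.1 hx).2
            exact ⟨i, (hmemT i).1 hx, rfl⟩
        have hT' : T = R ∨ ∃ t ∈ T, star t ∉ T := by
          rcases hor with h1 | ⟨i, h1, h2, h3⟩
          · left
            refine (Finset.filter_subset _ _).antisymm fun x hx => ?_
            have hx' := (mem_freeLabels_insert hinv).1 hx
            have : x ∈ Set.range a := by rw [hr]; exact hx'.1
            obtain ⟨i, rfl⟩ := this
            exact (hmemT i).2 ⟨h1 i (fun he => hx'.2.1 (by rw [he])) hx'.2.2, hx'.2.2⟩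
          · right
            refine ⟨a i, (hmemT i).2 ⟨h1, h2⟩, fun hmem => ?_⟩
            obtain ⟨i', hi', he⟩ := (Finset.mem_filter.1 hmem).2
            exact h3 i' hi' he
        obtain ⟨k, b, hbinj, hbr, hbg, r, hr1, hrk, hrT⟩ := exists_goodOrder hs
          (fun i hi => star_mem_freeLabels hinv hi) (Finset.filter_subset _ _)
          ⟨a i₀, (hmemT i₀).2 ⟨hi₀, hi₀'⟩⟩ hT'
        refine ⟨k, _, (ih hAF hc' _).2 ⟨b, hbinj, hbr, fun _ => rfl, hbg⟩, r, hr1, hrk, ?_⟩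
        exact (hunion a hinj hr j k b r hbr).2 (hTeq.trans hrT.symm)

/-- An ordering of the facets of a cube is a shelling if and only if it is a good order. -/
theorem isShelling_iff {F : Fin (2 * n) → Set (Euc n)} {star : Fin (2 * n) → Fin (2 * n)}
    (h : CubeFaces P F star) (hinv : Function.Involutive star) (hs : ∀ i, star i ≠ i)
    (hn : 0 < n) (hF : Function.Injective F) :
    IsShelling n P (2 * n) F ↔ IsGoodOrder star (id : Fin (2 * n) → Fin (2 * n)) := by
  have hAF : AntipodeFree star ∅ := fun i hi => hi.elim
  have hfree : freeLabels star ∅ = Finset.univ := by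
    ext a
    simp [mem_freeLabels]
  have hP : cubeFace P F ∅ = P := by simp [cubeFace]
  have hFi : ∀ a, cubeFace P F (insert a ∅) = F a := fun a => by
    rw [cubeFace_insert, hP]
    exact Set.inter_eq_right.2 (h.isExposed a).subset
  obtain ⟨d, rfl⟩ : ∃ d, n = d + 1 := ⟨n - 1, by omega⟩
  have := h.isShelling_cubeFace_iff hinv hs d hAF (by rw [hfree]; simp) F
  rw [hP] at this
  rw [this]
  simp only [hFi, hfree]
  constructor
  · rintro ⟨a, -, -, h3, h4⟩
    obtain rfl : a = id := funext fun k => (hF (h3 k)).symm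
    exact h4
  · intro hg
    exact ⟨id, Function.injective_id, by simp, fun _ => rfl, hg⟩

end CubeFaces

end Shellings

end CubeShelling

namespace CubeShelling

section Determinant

variable {n : ℕ}

/-- The determinant of `n` vectors of `ℝⁿ`. -/
noncomputable def vecDet (n : ℕ) : Euc n [⋀^Fin n]→ₗ[ℝ] ℝ :=
  (EuclideanSpace.basisFun (Fin n) ℝ).toBasis.det

theorem vecDet_eq_zero {h : Euc n →ₗ[ℝ] ℝ} (hne : h ≠ 0) {u : Fin n → Euc n}
    (hu : ∀ j, h (u j) = 0) : vecDet n u = 0 := by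
  by_contra hD
  have := ((EuclideanSpace.basisFun (Fin n) ℝ).toBasis.is_basis_iff_det).2 (isUnit_iff_ne_zero.2 hD)
  refine hne (LinearMap.ext_on_range (v := u) this.2 fun j => ?_)
  rw [hu, LinearMap.zero_apply]

theorem vecDet_ne_zero {u : Fin n → Euc n} (hu : LinearIndependent ℝ u) : vecDet n u ≠ 0 :=
  isUnit_iff_ne_zero.1 (((EuclideanSpace.basisFun (Fin n) ℝ).toBasis.is_basis_iff_det).1
    ⟨hu, hu.span_eq_top_of_card_eq_finrank' (by simp)⟩)

/-- If exchanging one vector of any transversal of the pairs `u i true`, `u i false` does not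
change the orientation, then no nonzero linear functional weakly separates all of the pairs. -/
theorem exists_same_sign {u : Fin n → Bool → Euc n}
    (hu : ∀ (σ : Fin n → Bool) (i : Fin n), ∃ h : Euc n →ₗ[ℝ] ℝ,
      (∀ j, j ≠ i → h (u j (σ j)) = 0) ∧ 0 < h (u i true) ∧ 0 < h (u i false))
    {f : Euc n →ₗ[ℝ] ℝ} (hf : f ≠ 0) : ∃ i, 0 < f (u i true) * f (u i false) := by
  classical
  by_contra! hcon
  have hpos : ∀ (σ : Fin n → Bool) (i : Fin n), ∃ h : Euc n →ₗ[ℝ] ℝ,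
      (∀ j, j ≠ i → h (u j (σ j)) = 0) ∧ ∀ b, 0 < h (u i b) := by
    intro σ i
    obtain ⟨h, h1, h2, h3⟩ := hu σ i
    exact ⟨h, h1, fun b => by cases b <;> assumption⟩
  have hne : ∀ σ : Fin n → Bool, vecDet n (fun i => u i (σ i)) ≠ 0 := by
    intro σ
    refine vecDet_ne_zero (Fintype.linearIndependent_iff.2 fun g hg i => ?_)
    obtain ⟨h, h1, h2⟩ := hpos σ i
    have := congrArg h hg
    rw [map_sum, map_zero, Finset.sum_eq_single i] at this
    · rw [map_smul, smul_eq_mul] at this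
      exact (mul_eq_zero.1 this).resolve_right (h2 _).ne'
    · intro j _ hj
      rw [map_smul, h1 j hj, smul_zero]
    · simp
  have hflip : ∀ (σ : Fin n → Bool) (i : Fin n) (b : Bool), ∃ c : ℝ, 0 < c ∧
      vecDet n (Function.update (fun j => u j (σ j)) i (u i b)) =
        c * vecDet n (fun j => u j (σ j)) := by
    intro σ i b
    obtain ⟨h, h1, h2⟩ := hpos σ i
    refine ⟨h (u i b) / h (u i (σ i)), div_pos (h2 _) (h2 _), ?_⟩
    have h0 : vecDet n (Function.update (fun j => u j (σ j)) i
        (u i b - (h (u i b) / h (u i (σ i))) • u i (σ i))) = 0 := by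
      refine vecDet_eq_zero (h := h) (fun h0 => ?_) fun j => ?_
      · have := h2 b
        rw [h0, LinearMap.zero_apply] at this
        exact lt_irrefl _ this
      · by_cases hj : j = i
        · subst hj
          have := (h2 (σ j)).ne'
          rw [Function.update_self, map_sub, map_smul, smul_eq_mul]
          field_simp
          ring
        · rw [Function.update_of_ne hj, h1 j hj]
    rw [AlternatingMap.map_update_sub, AlternatingMap.map_update_smul,
      Function.update_eq_self, smul_eq_mul] at h0
    linarith
  set D₀ := vecDet n (fun i => u i true) with hD₀
  have hsign : ∀ σ : Fin n → Bool, 0 < vecDet n (fun i => u i (σ i)) * D₀ := by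
    intro σ
    have key : ∀ T : Finset (Fin n),
        0 < vecDet n (fun i => u i (T.piecewise σ (fun _ => true) i)) * D₀ := by
      intro T
      induction T using Finset.induction_on with
      | empty =>
        simp only [Finset.piecewise_empty]
        exact mul_self_pos.2 (hne fun _ => true)
      | insert i T hi ih =>
        obtain ⟨c, hc, he⟩ := hflip (T.piecewise σ (fun _ => true)) i (σ i)
        have h1 : (fun j => u j ((insert i T).piecewise σ (fun _ => true) j)) =
            Function.update (fun j => u j (T.piecewise σ (fun _ => true) j)) i (u i (σ i)) := by
          funext j
          rw [Finset.piecewise_insert]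
          by_cases hj : j = i
          · subst hj; simp
          · simp [hj]
        rw [h1, he, mul_assoc]
        exact mul_pos hc ih
    simpa using key Finset.univ
  have hcoef : ∀ i, ∃ p q : ℝ, 0 ≤ p ∧ 0 ≤ q ∧ 0 < p + q ∧
      p * f (u i true) + q * f (u i false) = 0 := by
    intro i
    have h1 := hcon i
    by_cases h0 : f (u i true) = 0 ∧ f (u i false) = 0
    · exact ⟨1, 1, by norm_num, by norm_num, by norm_num, by rw [h0.1, h0.2]; norm_num⟩
    · refine ⟨|f (u i false)|, |f (u i true)|, abs_nonneg _, abs_nonneg _, ?_, ?_⟩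
      · by_contra! hle
        have h2 := abs_nonneg (f (u i true))
        have h3 := abs_nonneg (f (u i false))
        exact h0 ⟨abs_eq_zero.1 (by linarith), abs_eq_zero.1 (by linarith)⟩
      · rcases le_or_gt 0 (f (u i true)) with h2 | h2 <;> rcases le_or_gt 0 (f (u i false)) with h3 | h3
        · rcases mul_eq_zero.1 (le_antisymm h1 (mul_nonneg h2 h3)) with h4 | h4 <;> simp [h4]
        · rw [abs_of_nonneg h2, abs_of_neg h3]; ring
        · rw [abs_of_neg h2, abs_of_nonneg h3]; ring
        · exact absurd h1 (mul_pos_of_neg_of_neg h2 h3).not_ge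
  choose p q hp hq hpq hz using hcoef
  set x : Fin n → Euc n := fun i => p i • u i true + q i • u i false with hx
  have hmix : ∀ (T : Finset (Fin n)) (σ : Fin n → Bool),
      0 < vecDet n (T.piecewise x (fun i => u i (σ i))) * D₀ := by
    intro T
    induction T using Finset.induction_on with
    | empty => simpa using hsign
    | insert i T hi ih =>
      intro σ
      have h1 : ∀ b, Function.update (T.piecewise x (fun i => u i (σ i))) i (u i b) =
          T.piecewise x (fun j => u j (Function.update σ i b j)) := by
        intro b
        rw [T.update_piecewise_of_notMem x _ hi _]
        congr 1
        funext j
        by_cases hj : j = i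
        · subst hj; simp
        · simp [hj]
      rw [Finset.piecewise_insert, hx, AlternatingMap.map_update_add,
        AlternatingMap.map_update_smul, AlternatingMap.map_update_smul, ← hx, h1, h1,
        smul_eq_mul, smul_eq_mul, add_mul, mul_assoc, mul_assoc]
      have h2 := ih (Function.update σ i true)
      have h3 := ih (Function.update σ i false)
      rcases (hp i).eq_or_lt with h4 | h4
      · have h5 : 0 < q i := by have := hpq i; linarith
        rw [← h4, zero_mul, zero_add]
        exact mul_pos h5 h3
      · exact add_pos_of_pos_of_nonneg (mul_pos h4 h2) (mul_nonneg (hq i) h3.le)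
  have h1 := hmix Finset.univ (fun _ => true)
  rw [Finset.piecewise_univ, vecDet_eq_zero hf, zero_mul] at h1
  · exact lt_irrefl _ h1
  · intro j
    rw [hx, map_add, map_smul, map_smul, smul_eq_mul, smul_eq_mul]
    exact hz j

end Determinant

section LinearOrderings

variable {n : ℕ}

theorem exists_interior_level {C : Set (Euc n)} (hC : Convex ℝ C) (hint : (interior C).Nonempty)
    (f : Euc n →ₗ[ℝ] ℝ) {x y : Euc n} (hx : x ∈ C) (hy : y ∈ C) {c : ℝ} (hxc : f x < c)
    (hcy : c < f y) : ∃ z ∈ interior C, f z = c := by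
  obtain ⟨w, hw⟩ := hint
  have key : ∀ y ∈ C, ∀ t : ℝ, 0 < t → t < 1 → c = f w + t * (f y - f w) →
      ∃ z ∈ interior C, f z = c := by
    intro y hy t h0 h1 he
    refine ⟨(1 - t) • w + t • y,
      hC.combo_interior_self_mem_interior hw hy (by linarith) h0.le (by ring), ?_⟩
    rw [map_add, map_smul, map_smul, smul_eq_mul, smul_eq_mul, he]
    ring
  rcases lt_trichotomy (f w) c with h | h | h
  · have hd : 0 < f y - f w := by linarith
    refine key y hy ((c - f w) / (f y - f w)) (div_pos (by linarith) hd)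
      ((div_lt_one hd).2 (by linarith)) ?_
    field_simp
    ring
  · exact ⟨w, hw, h⟩
  · have hd : 0 < f w - f x := by linarith
    refine key x hx ((f w - c) / (f w - f x)) (div_pos (by linarith) hd)
      ((div_lt_one hd).2 (by linarith)) ?_
    field_simp
    ring

/-- The order in which a linear functional lists the vertices of a crosspolytope is good. -/
theorem CrossFaces.isGoodOrder_of_strictMono {C : Set (Euc n)} {v : Fin (2 * n) → Euc n}
    {star : Fin (2 * n) → Fin (2 * n)} (h : CrossFaces C v star)
    (hinv : Function.Involutive star) (hs : ∀ i, star i ≠ i) (hn : 0 < n)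
    (f : Euc n →ₗ[ℝ] ℝ) (hf : ∀ i j, i < j → f (v i) < f (v j)) :
    IsGoodOrder star (id : Fin (2 * n) → Fin (2 * n)) := by
  intro j hj0 hj
  by_contra! hcon
  have hcl : ∀ i : Fin (2 * n), (star i).1 < j ↔ i.1 < j := by
    have h1 : ∀ i : Fin (2 * n), i.1 < j → (star i).1 < j := fun i hi => by
      obtain ⟨k, hk, he⟩ := hcon i hi
      rw [id, id] at he
      rwa [← he]
    exact fun i => ⟨fun hi => hinv i ▸ h1 _ hi, h1 i⟩
  have hlt := hf ⟨j - 1, by omega⟩ ⟨j, hj⟩ (Fin.mk_lt_mk.2 (by omega))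
  obtain ⟨c, hc1, hc2⟩ := exists_between hlt
  obtain ⟨z, hz, hzc⟩ := exists_interior_level h.isPolytope.convex
    (h.interior_nonempty hinv hs hn) f (h.mem _) (h.mem _) hc1 hc2
  have hneg : ∀ i : Fin (2 * n), i.1 < j → f (v i - z) < 0 := by
    intro i hi
    have h1 : f (v i) ≤ f (v ⟨j - 1, by omega⟩) := by
      rcases eq_or_lt_of_le (Nat.le_sub_one_of_lt hi) with h2 | h2
      · rw [show i = ⟨j - 1, by omega⟩ from Fin.ext h2]
      · exact (hf _ _ (Fin.lt_def.2 h2)).le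
    rw [map_sub, hzc]; linarith
  have hpos : ∀ i : Fin (2 * n), ¬ i.1 < j → 0 < f (v i - z) := by
    intro i hi
    have h1 : f (v ⟨j, hj⟩) ≤ f (v i) := by
      rcases eq_or_lt_of_le (not_lt.1 hi) with h2 | h2
      · rw [show i = ⟨j, hj⟩ from Fin.ext h2.symm]
      · exact (hf _ _ (Fin.lt_def.2 h2)).le
    rw [map_sub, hzc]; linarith
  obtain ⟨a, hmono, ha⟩ := exists_pairs hinv hs
  have hstar : ∀ k k', star (a k) ≠ a k' := by
    intro k k' hk
    have h1 := (ha _).1 ⟨k, rfl⟩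
    have h2 := (ha _).1 ⟨k', rfl⟩
    rw [← hk, hinv] at h2
    exact lt_asymm h1 h2
  set lab : Fin n → Bool → Fin (2 * n) := fun k b => if b then a k else star (a k) with hlab
  have hlabinj : ∀ k k' b b', lab k b = lab k' b' → k = k' ∧ b = b' := by
    intro k k' b b' he
    cases b <;> cases b' <;> simp only [hlab, if_true, if_false, Bool.false_eq_true] at he
    · exact ⟨hmono.injective (hinv.injective he), rfl⟩
    · exact absurd he (hstar _ _)
    · exact absurd he.symm (hstar _ _)
    · exact ⟨hmono.injective he, rfl⟩
  have hstarlab : ∀ k b, star (lab k b) = lab k (!b) := by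
    intro k b
    cases b <;> simp [hlab, hinv (a k)]
  have hg : ∀ σ : Fin n → Bool, ∃ g : Euc n →ₗ[ℝ] ℝ,
      (∀ k, g (v (lab k (σ k)) - z) = 1) ∧ ∀ k, g (v (lab k (!σ k)) - z) < 1 := by
    intro σ
    have hoff : ∀ k, lab k (!σ k) ∉ Set.range fun k => lab k (σ k) := by
      rintro k ⟨k', hk'⟩
      obtain ⟨rfl, h1⟩ := hlabinj _ _ _ _ hk'
      simp at h1
    obtain ⟨l, c, hle, h1, h2⟩ := h.exists_functional (S := Set.range fun k => lab k (σ k)) (by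
      rintro _ ⟨k, rfl⟩ hmem
      rw [hstarlab] at hmem
      exact hoff k hmem) ⟨_, ⟨⟨0, hn⟩, rfl⟩⟩
    have hlz : 0 < c - l z := sub_pos.2 (lt_of_mem_interior hle hz (h2 _ (hoff ⟨0, hn⟩)))
    refine ⟨(c - l z)⁻¹ • l.toLinearMap, fun k => ?_, fun k => ?_⟩
    · have := h1 _ ⟨k, rfl⟩
      simp only [LinearMap.smul_apply, ContinuousLinearMap.coe_coe, map_sub, smul_eq_mul]
      rw [← mul_sub, this, inv_mul_cancel₀ hlz.ne']
    · have := h2 _ (hoff k)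
      simp only [LinearMap.smul_apply, ContinuousLinearMap.coe_coe, map_sub, smul_eq_mul]
      rw [← mul_sub, inv_mul_lt_iff₀ hlz]
      linarith
  choose g hg1 hg2 using hg
  obtain ⟨k, hk⟩ := exists_same_sign (f := f)
    (u := fun k b => if b then v (lab k true) - z else -(v (lab k false) - z)) (by
      intro σ i
      have ht := hg1 (Function.update σ i true)
      have ht' := hg2 (Function.update σ i true)
      have hf := hg1 (Function.update σ i false)
      have hf' := hg2 (Function.update σ i false)
      refine ⟨g (Function.update σ i true) - g (Function.update σ i false), fun j hj => ?_, ?_, ?_⟩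
      · have h1 := ht j
        have h2 := hf j
        rw [Function.update_of_ne hj] at h1 h2
        cases hσ : σ j <;> rw [hσ] at h1 h2 <;>
          simp only [if_true, if_false, Bool.false_eq_true, LinearMap.sub_apply, map_neg, h1, h2,
            sub_self, neg_zero]
      · have h1 := ht i
        have h2 := hf' i
        rw [Function.update_self] at h1 h2
        rw [Bool.not_false] at h2
        simp only [if_true, LinearMap.sub_apply]
        linarith
      · have h1 := ht' i
        have h2 := hf i
        rw [Function.update_self] at h1 h2
        rw [Bool.not_true] at h1
        simp only [if_false, Bool.false_eq_true, LinearMap.sub_apply, map_neg]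
        linarith) (fun h0 => by
      rw [h0, LinearMap.zero_apply, LinearMap.zero_apply] at hlt
      exact lt_irrefl _ hlt)
  simp only [if_true, if_false, Bool.false_eq_true, map_neg] at hk
  have hl : star (lab k true) = lab k false := hstarlab k true
  have hiff := hcl (lab k true)
  rw [hl] at hiff
  by_cases hkj : (lab k true).1 < j
  · have h1 := hneg _ hkj
    have h2 := hneg _ (hiff.2 hkj)
    nlinarith
  · have h1 := hpos _ hkj
    have h2 := hpos _ (fun hh => hkj (hiff.1 hh))
    nlinarith

theorem exists_recursion {E : Type*} (F : ∀ k : Fin n, (∀ j, j < k → E) → E) :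
    ∃ c : Fin n → E, ∀ k, c k = F k fun j _ => c j :=
  ⟨WellFounded.fix wellFounded_lt F, WellFounded.fix_eq wellFounded_lt F⟩

/-- A good order is realized by a linear functional on some crosspolytope. -/
theorem exists_crossFaces_of_isGoodOrder {star : Fin (2 * n) → Fin (2 * n)}
    (hinv : Function.Involutive star) (hs : ∀ i, star i ≠ i) (hn : 0 < n)
    (hg : IsGoodOrder star (id : Fin (2 * n) → Fin (2 * n))) :
    ∃ (C : Set (Euc n)) (v : Fin (2 * n) → Euc n) (f : Euc n →ₗ[ℝ] ℝ),
      CrossFaces C v star ∧ ∀ i j, i < j → f (v i) < f (v j) := by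
  classical
  obtain ⟨a, hmono, ha⟩ := exists_pairs hinv hs
  let z : Fin n := ⟨0, hn⟩
  have hlt : ∀ k, a k < star (a k) := fun k => (ha _).1 ⟨k, rfl⟩
  set α : Fin n → ℝ := fun k => ((a k).1 : ℝ) with hα
  set β : Fin n → ℝ := fun k => ((star (a k)).1 : ℝ) with hβ
  have hαβ : ∀ k, α k < β k := fun k => Nat.cast_lt.2 (hlt k)
  have hpar : ∀ k, ∃ (p : Fin n) (γ : ℝ), α k < γ ∧ γ < β k ∧
      (k ≠ z → p < k ∧ α p < γ ∧ γ < β p) := by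
    intro k
    by_cases hk : k = z
    · obtain ⟨γ, h1, h2⟩ := exists_between (hαβ k)
      exact ⟨z, γ, h1, h2, fun h => absurd hk h⟩
    · have hzk : z < k := by
        refine lt_of_le_of_ne (Fin.le_def.2 (Nat.zero_le _)) (Ne.symm hk)
      have h0 : 0 < (a k).1 := lt_of_le_of_lt (Nat.zero_le _) (hmono hzk)
      obtain ⟨i, hi, hi'⟩ := hg (a k).1 h0 (a k).2
      have h1 : a k ≤ star i := not_lt.1 fun h => hi' (star i) h rfl
      have h2 : i < star i := lt_of_lt_of_le hi h1
      obtain ⟨p, rfl⟩ := (ha i).2 h2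
      have hpk : p < k := hmono.lt_iff_lt.1 hi
      have h3 : a k < star (a p) := lt_of_le_of_ne h1 fun he => by
        have := hlt k
        rw [he, hinv] at this
        exact lt_asymm this h2
      obtain ⟨γ, h4, h5⟩ := exists_between (lt_min (hαβ k) (show α k < β p from Nat.cast_lt.2 h3))
      exact ⟨p, γ, h4, h5.trans_le (min_le_left _ _), fun _ =>
        ⟨hpk, (show α p < α k from Nat.cast_lt.2 (hmono hpk)).trans h4,
          h5.trans_le (min_le_right _ _)⟩⟩
  choose π γ hγ1 hγ2 hπ using hpar
  set e : Fin n → Euc n := fun k => EuclideanSpace.single k (1 : ℝ) with he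
  obtain ⟨c, hc⟩ := exists_recursion (n := n) (E := Euc n) fun k rec =>
    if h : k = z then γ k • e k else rec (π k) (hπ k h).1 + (γ k - γ (π k)) • e (π k)
  have hcz : c z = γ z • e z := by rw [hc, dif_pos rfl]
  have hck : ∀ k, k ≠ z → c k = c (π k) + (γ k - γ (π k)) • e (π k) := by
    intro k hk
    rw [hc, dif_neg hk]
  have hκ : ∀ i, ∃ k, i = a k ∨ i = star (a k) := by
    intro i
    rcases lt_or_gt_of_ne (hs i) with h1 | h1
    · obtain ⟨k, hk⟩ := (ha (star i)).2 (by rwa [hinv])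
      exact ⟨k, Or.inr (by rw [hk, hinv])⟩
    · obtain ⟨k, hk⟩ := (ha i).2 h1
      exact ⟨k, Or.inl hk.symm⟩
  choose κ hκ using hκ
  have hκa : ∀ k, κ (a k) = k := by
    intro k
    rcases hκ (a k) with h1 | h1
    · exact (hmono.injective h1).symm
    · have h2 := hlt k
      have h3 := hlt (κ (a k))
      rw [h1, hinv] at h2
      rw [← h1] at h3 h2
      exact absurd h2 (lt_asymm h3)
  have hκs : ∀ k, κ (star (a k)) = k := by
    intro k
    rcases hκ (star (a k)) with h1 | h1
    · have h2 := hlt k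
      have h3 := hlt (κ (star (a k)))
      rw [← h1, hinv] at h3
      exact absurd h2 (lt_asymm h3)
    · exact (hmono.injective (hinv.injective h1)).symm
  set v : Fin (2 * n) → Euc n := fun i => c (κ i) + ((i.1 : ℝ) - γ (κ i)) • e (κ i) with hv
  have hva : ∀ k, v (a k) = c k + (α k - γ k) • e k := fun k => by simp only [hv, hκa, hα]
  have hvs : ∀ k, v (star (a k)) = c k + (β k - γ k) • e k := fun k => by simp only [hv, hκs, hβ]
  set f : Euc n →ₗ[ℝ] ℝ := ∑ k, (EuclideanSpace.proj k : Euc n →L[ℝ] ℝ).toLinearMap with hf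
  have hfe : ∀ k, f (e k) = 1 := by
    intro k
    simp [hf, he, LinearMap.sum_apply]
  have hfc : ∀ k, f (c k) = γ k := by
    intro k
    induction k using WellFoundedLT.induction with
    | _ k ih =>
      by_cases hk : k = z
      · rw [hk, hcz, map_smul, hfe, smul_eq_mul, mul_one]
      · rw [hck k hk, map_add, map_smul, hfe, ih _ (hπ k hk).1, smul_eq_mul]
        ring
  have hfv : ∀ i, f (v i) = i.1 := by
    intro i
    simp only [hv]
    rw [map_add, map_smul, hfc, hfe, smul_eq_mul]
    ring
  refine ⟨_, v, f, CrossFaces.of_functionals v star ?_ ?_, fun i j hij => ?_⟩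
  · intro S hS
    set r : Fin n → ℝ := fun k => if a k ∈ S then 1 / (γ k - α k) else
      if star (a k) ∈ S then -(1 / (β k - γ k)) else 0 with hr
    have hrpos : ∀ k t, α k < t → t < β k → 0 < 1 + r k * (t - γ k) := by
      intro k t h1 h2
      have h3 : 0 < γ k - α k := sub_pos.2 (hγ1 k)
      have h4 : 0 < β k - γ k := sub_pos.2 (hγ2 k)
      simp only [hr]
      split_ifs
      · have : 1 + 1 / (γ k - α k) * (t - γ k) = (t - α k) / (γ k - α k) := by field_simp; ring
        rw [this]
        exact div_pos (by linarith) h3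
      · have : 1 + -(1 / (β k - γ k)) * (t - γ k) = (β k - t) / (β k - γ k) := by field_simp; ring
        rw [this]
        exact div_pos (by linarith) h4
      · simp
    obtain ⟨Y, hY⟩ := exists_recursion (n := n) (E := ℝ) fun k rec =>
      if h : k = z then 1 else rec (π k) (hπ k h).1 * (1 + r (π k) * (γ k - γ (π k)))
    have hYz : Y z = 1 := by rw [hY, dif_pos rfl]
    have hYk : ∀ k, k ≠ z → Y k = Y (π k) * (1 + r (π k) * (γ k - γ (π k))) := by
      intro k hk
      rw [hY, dif_neg hk]
    have hYpos : ∀ k, 0 < Y k := by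
      intro k
      induction k using WellFoundedLT.induction with
      | _ k ih =>
        by_cases hk : k = z
        · rw [hk, hYz]; exact one_pos
        · obtain ⟨h1, h2, h3⟩ := hπ k hk
          rw [hYk k hk]
          exact mul_pos (ih _ h1) (hrpos _ _ h2 h3)
    set l : StrongDual ℝ (Euc n) := ∑ k, (-(Y k * r k)) • (EuclideanSpace.proj k : Euc n →L[ℝ] ℝ)
      with hl
    have hle : ∀ k, l (e k) = -(Y k * r k) := by
      intro k
      simp [hl, he]
    have hlc : ∀ k, (1 + l (c z)) - l (c k) = Y k := by
      intro k
      induction k using WellFoundedLT.induction with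
      | _ k ih =>
        by_cases hk : k = z
        · rw [hk, hYz]; ring
        · have := ih _ (hπ k hk).1
          rw [hck k hk, map_add, map_smul, hle, hYk k hk, smul_eq_mul]
          linear_combination this
    have hlv : ∀ k t, l (c k + (t - γ k) • e k) =
        (1 + l (c z)) - Y k * (1 + r k * (t - γ k)) := by
      intro k t
      rw [map_add, map_smul, hle, smul_eq_mul]
      linear_combination -(hlc k)
    have h3 : ∀ k, γ k - α k ≠ 0 := fun k => (sub_pos.2 (hγ1 k)).ne'
    have h4 : ∀ k, β k - γ k ≠ 0 := fun k => (sub_pos.2 (hγ2 k)).ne'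
    have hgap : ∀ k, 0 < 1 / (γ k - α k) ∧ 0 < 1 / (β k - γ k) := fun k =>
      ⟨one_div_pos.2 (sub_pos.2 (hγ1 k)), one_div_pos.2 (sub_pos.2 (hγ2 k))⟩
    refine ⟨l, 1 + l (c z), fun i hi => ?_, fun i hi => ?_⟩
    · rcases hκ i with h1 | h1
      · rw [h1] at hi ⊢
        have hrk : r (κ i) = 1 / (γ (κ i) - α (κ i)) := by simp only [hr, if_pos hi]
        rw [hva, hlv, hrk]
        have := h3 (κ i)
        field_simp
        ring
      · rw [h1] at hi ⊢
        have hna : a (κ i) ∉ S := fun hh => hS _ hh hi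
        have hrk : r (κ i) = -(1 / (β (κ i) - γ (κ i))) := by simp only [hr, if_neg hna, if_pos hi]
        rw [hvs, hlv, hrk]
        have := h4 (κ i)
        field_simp
        ring
    · rcases hκ i with h1 | h1
      · rw [h1] at hi ⊢
        rw [hva, hlv]
        have hpos : 0 < 1 + r (κ i) * (α (κ i) - γ (κ i)) := by
          simp only [hr, if_neg hi]
          have := hgap (κ i)
          have := hγ1 (κ i)
          split_ifs
          · nlinarith
          · simp
        have := mul_pos (hYpos (κ i)) hpos
        linarith
      · rw [h1] at hi ⊢
        rw [hvs, hlv]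
        have hpos : 0 < 1 + r (κ i) * (β (κ i) - γ (κ i)) := by
          simp only [hr, if_neg hi]
          have := hgap (κ i)
          have := hγ2 (κ i)
          split_ifs
          · nlinarith
          · simp
        have := mul_pos (hYpos (κ i)) hpos
        linarith
  · intro l C hle
    have hline : ∀ k t, α k < t → t < β k → (l (c k + (t - γ k) • e k) = C ↔
        l (v (a k)) = C ∧ l (v (star (a k))) = C) := by
      intro k t h1 h2
      have h3 := hle (a k)
      have h4 := hle (star (a k))
      rw [hva] at h3 ⊢
      rw [hvs] at h4 ⊢
      rw [map_add, map_smul, smul_eq_mul] at h3 h4 ⊢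
      rw [map_add, map_smul, smul_eq_mul, map_add, map_smul, smul_eq_mul]
      constructor
      · intro h5
        have h6 : l (e k) = 0 := by nlinarith
        rw [h6] at h5 ⊢
        constructor <;> linarith
      · rintro ⟨h5, h6⟩
        have h7 : (β k - α k) * l (e k) = 0 := by linarith
        have h8 : l (e k) = 0 := (mul_eq_zero.1 h7).resolve_left (sub_pos.2 (hαβ k)).ne'
        rw [h8] at h5 ⊢
        linarith
    have hstep : ∀ k, k ≠ z → ((l (v (a k)) = C ∧ l (v (star (a k))) = C) ↔
        (l (v (a (π k))) = C ∧ l (v (star (a (π k)))) = C)) := by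
      intro k hk
      obtain ⟨-, h2, h3⟩ := hπ k hk
      rw [← hline k (γ k) (hγ1 k) (hγ2 k), ← hline (π k) (γ k) h2 h3, hck k hk]
      simp
    have hroot : ∀ k, (l (v (a k)) = C ∧ l (v (star (a k))) = C) ↔
        (l (v (a z)) = C ∧ l (v (star (a z))) = C) := by
      intro k
      induction k using WellFoundedLT.induction with
      | _ k ih =>
        by_cases hk : k = z
        · rw [hk]
        · rw [hstep k hk, ih _ (hπ k hk).1]
    intro i hi hi' j
    have h1 : l (v (a (κ i))) = C ∧ l (v (star (a (κ i)))) = C := by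
      rcases hκ i with h1 | h1
      · rw [← h1]; exact ⟨hi, hi'⟩
      · refine ⟨?_, by rwa [← h1]⟩
        have h5 : star i = a (κ i) := (congrArg star h1).trans (hinv _)
        rwa [h5] at hi'
    have h2 := (hroot (κ j)).2 ((hroot (κ i)).1 h1)
    rcases hκ j with h3 | h3
    · rw [h3]; exact h2.1
    · rw [h3]; exact h2.2
  · rw [hfv, hfv]
    exact Nat.cast_lt.2 hij

end LinearOrderings

end CubeShelling

namespace CubeShelling

section Duality

variable {n : ℕ}

theorem inner_eq_of_mem_affineSpan {S : Set (Euc n)} {w : Euc n} {c : ℝ}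
    (hS : ∀ y ∈ S, inner ℝ w y = c) {y : Euc n} (hy : y ∈ affineSpan ℝ S) : inner ℝ w y = c := by
  refine affineSpan_induction (p := fun y => inner ℝ w y = c) hy hS fun r a b d ha hb hd => ?_
  rw [vsub_eq_sub, vadd_eq_add, inner_add_right, inner_smul_right, inner_sub_right, ha, hb, hd]
  simp

/-- The translation by `-x`. -/
noncomputable def translation (x : Euc n) : Euc n ≃ᵃ[ℝ] Euc n := AffineEquiv.constVAdd ℝ (Euc n) (-x)

theorem translation_apply (x y : Euc n) : translation x y = y - x := by
  change -x + y = y - x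
  abel

theorem zero_mem_interior_translation {Q : Set (Euc n)} {x : Euc n} (hx : x ∈ interior Q) :
    (0 : Euc n) ∈ interior (translation x '' Q) := by
  have h1 : translation x '' Q = Homeomorph.addLeft (-x) '' Q := rfl
  rw [h1, ← (Homeomorph.addLeft (-x)).image_interior]
  exact ⟨x, hx, by simp⟩

theorem isLPOrdering_of_isLineShelling {P C : Set (Euc n)}
    (Φ : Face C ≃o (Face P)ᵒᵈ) {m : ℕ} {F : Fin m → Set (Euc n)} {v : Fin m → Euc n}
    (hF : ∀ i, ∃ h : IsExposed ℝ C {v i}, (OrderDual.ofDual (Φ ⟨{v i}, h⟩)).val = F i)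
    (hL : IsLineShelling P F) : IsLPOrdering C v := by
  obtain ⟨Q, φ, F', x, u, hQ, hφ, hx, -, t, ht, hlt⟩ := hL
  have hQ₀ := hQ.image_affineEquiv (translation x)
  have h0 := zero_mem_interior_translation hx
  set Q₀ := translation x '' Q with hQ₀def
  have hC' := hQ₀.polarBody h0
  let ψ : Face C ≃o Face (polarBody Q₀) := Φ.trans (φ.dual.trans ((faceImage (translation x) Q).dual.trans
    ((polarIso hQ₀ h0).dual.trans (OrderIso.dualDual _).symm)))
  have hval : ∀ i (h : IsExposed ℝ C {v i}),
      (ψ ⟨{v i}, h⟩).1 = dualFace Q₀ (translation x '' F' i) := by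
    intro i h
    obtain ⟨h₁, h₂⟩ := hF i
    obtain ⟨h₃, h₄⟩ := hφ i
    have h5 : OrderDual.ofDual (Φ ⟨{v i}, h⟩) = ⟨F i, h₃⟩ := Subtype.ext h₂
    rw [← h₄, ← h5]
    rfl
  have hvert : ∀ i, ∃ w, ∃ h : IsExposed ℝ C {v i}, (ψ ⟨{v i}, h⟩ : Set (Euc n)) = {w} := by
    intro i
    obtain ⟨h₁, -⟩ := hF i
    have ha : IsAtom (ψ ⟨{v i}, h₁⟩) := (OrderIso.isAtom_iff _ _).2 (isAtom_singleton h₁)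
    obtain ⟨w, -, hw⟩ := (hC'.isAtom_iff _).1 ha
    exact ⟨w, h₁, hw⟩
  choose v' hv' using hvert
  have hin : ∀ i, ∀ y ∈ F' i, inner ℝ (v' i) y = 1 + inner ℝ (v' i) x := by
    intro i y hy
    obtain ⟨h₁, h₂⟩ := hv' i
    have h3 : v' i ∈ dualFace Q₀ (translation x '' F' i) := by
      rw [← hval i h₁, h₂]; rfl
    have h4 := h3.2 _ ⟨y, hy, rfl⟩
    rw [translation_apply, real_inner_comm, inner_sub_right] at h4
    linarith
  have hts : ∀ i, t i * inner ℝ (-u) (v' i) = -1 := by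
    intro i
    have := inner_eq_of_mem_affineSpan (hin i) (ht i)
    rw [inner_add_right, inner_smul_right, real_inner_comm] at this
    rw [inner_neg_left]
    have h2 : inner ℝ (v' i) u = inner ℝ u (v' i) := real_inner_comm _ _
    rw [h2] at this
    linear_combination -this
  refine ⟨polarBody Q₀, ψ, v', (innerSL ℝ (-u)).toLinearMap, hC', hv', fun i j hij => ?_⟩
  exact (passedBefore_iff (hts i) (hts j)).1 (hlt i j hij)

theorem CrossFaces.isLineShelling_of_isLPOrdering {P C : Set (Euc n)}
    {F : Fin (2 * n) → Set (Euc n)} {v : Fin (2 * n) → Euc n}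
    {star : Fin (2 * n) → Fin (2 * n)} (h : CrossFaces C v star)
    (hinv : Function.Involutive star) (hs : ∀ i, star i ≠ i) (hn : 0 < n)
    (Φ : Face C ≃o (Face P)ᵒᵈ)
    (hF : ∀ i, ∃ h : IsExposed ℝ C {v i}, (OrderDual.ofDual (Φ ⟨{v i}, h⟩)).val = F i)
    (hL : IsLPOrdering C v) : IsLineShelling P F := by
  obtain ⟨C', ψ, v', f, hC', hψ, hlt⟩ := hL
  have h' := h.transport hs hC' ψ hψ
  obtain ⟨c, hc1, hc2⟩ := exists_between
    (hlt ⟨0, by omega⟩ ⟨1, by omega⟩ (Fin.mk_lt_mk.2 zero_lt_one))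
  obtain ⟨z, hz, hzc⟩ := exists_interior_level hC'.convex (h'.interior_nonempty hinv hs hn) f
    (h'.mem _) (h'.mem _) hc1 hc2
  have hne : ∀ i, f (v' i) - c ≠ 0 := by
    intro i
    rcases Nat.eq_zero_or_pos i.1 with h0 | h0
    · rw [show i = ⟨0, by omega⟩ from Fin.ext h0]
      exact (sub_neg.2 hc1).ne
    · have h1 : f (v' ⟨1, by omega⟩) ≤ f (v' i) := by
        rcases eq_or_lt_of_le (Nat.succ_le_of_lt h0) with h2 | h2
        · rw [show i = ⟨1, by omega⟩ from Fin.ext h2.symm]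
        · exact (hlt _ _ (Fin.lt_def.2 h2)).le
      exact (sub_pos.2 (hc2.trans_le h1)).ne'
  have hC₀ := hC'.image_affineEquiv (translation z)
  have h0 := zero_mem_interior_translation hz
  have hw : CrossFaces (translation z '' C') (fun i => translation z (v' i)) star :=
    h'.transport hs hC₀ (faceImage (translation z) C') fun i =>
      ⟨(h'.singleton_face hs i).1, Set.image_singleton⟩
  set C₀ := translation z '' C' with hC₀def
  let φ : Face P ≃o Face (polarBody C₀) := (OrderIso.dualDual _).trans (Φ.symm.dual.trans
    (ψ.dual.trans ((faceImage (translation z) C').dual.trans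
      ((polarIso hC₀ h0).dual.trans (OrderIso.dualDual _).symm))))
  set f₀ := (InnerProductSpace.toDual ℝ (Euc n)).symm (LinearMap.toContinuousLinearMap f) with hf₀
  have hf : ∀ y, inner ℝ f₀ y = f y := fun y => InnerProductSpace.toDual_symm_apply
  have hfw : ∀ i, inner ℝ f₀ (translation z (v' i)) = f (v' i) - c := by
    intro i
    rw [hf, translation_apply, map_sub, hzc]
  refine ⟨polarBody C₀, φ, fun i => dualFacet C₀ (translation z (v' i)), 0, -f₀,
    hC₀.polarBody h0, fun i => ?_, ?_⟩
  · obtain ⟨h₁, h₂⟩ := hF i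
    have h₃ : IsExposed ℝ P (F i) := h₂ ▸ (OrderDual.ofDual (Φ ⟨{v i}, h₁⟩)).2
    refine ⟨h₃, ?_⟩
    have h4 : Φ.symm (OrderDual.toDual ⟨F i, h₃⟩) = ⟨{v i}, h₁⟩ := by
      rw [OrderIso.symm_apply_eq]
      exact congrArg OrderDual.toDual (Subtype.ext h₂.symm)
    obtain ⟨h₅, h₆⟩ := hψ i
    have h7 : (φ ⟨F i, h₃⟩).1 =
        dualFace C₀ (translation z '' (ψ (Φ.symm (OrderDual.toDual ⟨F i, h₃⟩))).1) := rfl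
    rw [h7, h4, h₆, Set.image_singleton, dualFace_singleton]
  · refine (isLineShellingAlong_polarBody_iff hC₀ h0 f₀ ⟨hw.injective hs, hw.range_eq hs⟩).1
      ⟨fun i => ?_, fun i j hij => ?_⟩
    · rw [hfw]; exact hne i
    · rw [hfw, hfw]
      exact sub_lt_sub_right (hlt i j hij) c

theorem CrossFaces.isLPOrdering_iff {C : Set (Euc n)} {v : Fin (2 * n) → Euc n}
    {star : Fin (2 * n) → Fin (2 * n)} (h : CrossFaces C v star)
    (hinv : Function.Involutive star) (hs : ∀ i, star i ≠ i) (hn : 0 < n) :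
    IsLPOrdering C v ↔ IsGoodOrder star (id : Fin (2 * n) → Fin (2 * n)) := by
  constructor
  · rintro ⟨C', ψ, v', f, hC', hψ, hlt⟩
    exact (h.transport hs hC' ψ hψ).isGoodOrder_of_strictMono hinv hs hn f hlt
  · intro hg
    obtain ⟨C', v', f, h', hlt⟩ := exists_crossFaces_of_isGoodOrder hinv hs hn hg
    obtain ⟨ψ, hψ⟩ := h.exists_iso hs h'
    exact ⟨C', ψ, v', f, h'.isPolytope, hψ, hlt⟩

theorem zero_mem_interior_stdCrosspolytope (hn : 0 < n) :
    (0 : Euc n) ∈ interior (stdCrosspolytope n) := by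
  have hcv : Convex ℝ (stdCrosspolytope n) := convex_convexHull ℝ _
  have hn' : (0 : ℝ) < n := Nat.cast_pos.2 hn
  rw [mem_interior_iff_mem_nhds, Metric.mem_nhds_iff]
  refine ⟨1 / n, by positivity, fun x hx => ?_⟩
  rw [mem_ball_zero_iff, lt_div_iff₀ hn'] at hx
  have hmem : ∀ i, (n * x i) • EuclideanSpace.single i (1 : ℝ) ∈ stdCrosspolytope n := by
    intro i
    have h1 : |x i| ≤ ‖x‖ := PiLp.norm_apply_le x i
    have h2 : |n * x i| ≤ 1 := by
      rw [abs_mul, abs_of_pos hn']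
      nlinarith
    obtain ⟨h3, h4⟩ := abs_le.1 h2
    have h5 := hcv ((crossFaces_std n).mem (i, true)) ((crossFaces_std n).mem (i, false))
      (show 0 ≤ (1 + n * x i) / 2 by linarith) (show 0 ≤ (1 - n * x i) / 2 by linarith) (by ring)
    convert h5 using 1
    simp only [stdVertex, if_true, if_false, Bool.false_eq_true]
    module
  have h6 : x = ∑ i, (1 / n : ℝ) • ((n * x i) • EuclideanSpace.single i (1 : ℝ)) := by
    ext j
    simp [Finset.sum_apply, Pi.single_apply]
    field_simp
  rw [h6]
  refine hcv.sum_mem (fun _ _ => by positivity) ?_ fun i _ => hmem i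
  simp [hn'.ne']

theorem mem_polarBody_stdCrosspolytope {y : Euc n} :
    y ∈ polarBody (stdCrosspolytope n) ↔ ∀ i, -1 ≤ y i ∧ y i ≤ 1 := by
  have hs : ∀ p : Fin n × Bool, (p.1, !p.2) ≠ p := by
    rintro ⟨i, b⟩; cases b <;> simp
  have hin : ∀ p, inner ℝ (stdVertex n p) y = (if p.2 then (1 : ℝ) else -1) * y p.1 := by
    intro p
    rw [stdVertex, inner_smul_left, EuclideanSpace.inner_single_left]
    simp
  rw [(crossFaces_std n).isPolytope.mem_polarBody_iff, ← (crossFaces_std n).range_eq hs,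
    Set.forall_mem_range]
  simp only [hin]
  constructor
  · intro h i
    have h1 := h (i, true)
    have h2 := h (i, false)
    simp only [if_true, if_false, Bool.false_eq_true] at h1 h2
    constructor <;> linarith
  · rintro h ⟨i, b⟩
    have := h i
    cases b <;> simp only [if_true, if_false, Bool.false_eq_true] <;> linarith

/-- The map `x ↦ 2 x - 1`. -/
noncomputable def cubeScaling (n : ℕ) : Euc n ≃ᵃ[ℝ] Euc n :=
  (LinearEquiv.smulOfNeZero ℝ (Euc n) (2 : ℝ) two_ne_zero).toAffineEquiv.trans
    (translation (WithLp.toLp 2 fun _ => 1))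

theorem cubeScaling_apply (x : Euc n) (i : Fin n) : cubeScaling n x i = 2 * x i - 1 := by
  have : cubeScaling n x = translation (WithLp.toLp 2 fun _ => 1) ((2 : ℝ) • x) := rfl
  rw [this, translation_apply]
  simp

theorem polarBody_stdCrosspolytope :
    polarBody (stdCrosspolytope n) = cubeScaling n '' stdCube n := by
  ext y
  rw [mem_polarBody_stdCrosspolytope]
  constructor
  · intro h
    refine ⟨(cubeScaling n).symm y, fun i => ?_, (cubeScaling n).apply_symm_apply y⟩
    have h1 := cubeScaling_apply ((cubeScaling n).symm y) i
    rw [AffineEquiv.apply_symm_apply] at h1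
    have := h i
    constructor <;> linarith
  · rintro ⟨x, hx, rfl⟩ i
    rw [cubeScaling_apply]
    have := hx i
    constructor <;> linarith

theorem exists_stdCube_duality (hn : 0 < n) :
    Nonempty (Face (stdCrosspolytope n) ≃o (Face (stdCube n))ᵒᵈ) := by
  have h := polarIso (crossFaces_std n).isPolytope (zero_mem_interior_stdCrosspolytope hn)
  rw [polarBody_stdCrosspolytope] at h
  exact ⟨h.trans (faceImage (cubeScaling n) (stdCube n)).symm.dual⟩

/-- The facets of a cube are dual to the vertices of a crosspolytope. -/
theorem exists_dual_vertexOrdering {P C : Set (Euc n)} (hC : IsPolytope C)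
    (Φ : Face C ≃o (Face P)ᵒᵈ) {m : ℕ} {F : Fin m → Set (Euc n)} (hF : IsFacetOrdering P F) :
    ∃ v : Fin m → Euc n, IsVertexOrdering C v ∧
      ∀ i, ∃ h : IsExposed ℝ C {v i}, (OrderDual.ofDual (Φ ⟨{v i}, h⟩)).val = F i := by
  have hFm : ∀ i, F i ∈ facets P := fun i => hF.2 ▸ Set.mem_range_self i
  have hex : ∀ i, ∃ w, ∃ h : IsExposed ℝ C {w}, (OrderDual.ofDual (Φ ⟨{w}, h⟩)).val = F i := by
    intro i
    have hc : IsCoatom (⟨F i, (hFm i).1.1⟩ : Face P) := (isCoatom_iff_mem_facets _).2 (hFm i)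
    have ha : IsAtom (Φ.symm (OrderDual.toDual ⟨F i, (hFm i).1.1⟩)) :=
      (OrderIso.isAtom_iff _ _).2 hc.dual
    obtain ⟨w, hw, hwF⟩ := (hC.isAtom_iff _).1 ha
    refine ⟨w, hw, ?_⟩
    have h1 : Φ.symm (OrderDual.toDual ⟨F i, (hFm i).1.1⟩) = ⟨{w}, hw⟩ := Subtype.ext hwF
    rw [← h1, Φ.apply_symm_apply]
    rfl
  choose v hv using hex
  refine ⟨v, ⟨fun i j hij => hF.1 ?_, ?_⟩, hv⟩
  · obtain ⟨h1, h2⟩ := hv i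
    obtain ⟨h3, h4⟩ := hv j
    rw [← h2, ← h4]
    congr 3
    exact Subtype.ext (congrArg (fun w => ({w} : Set (Euc n))) hij)
  · apply Set.Subset.antisymm
    · rintro _ ⟨i, rfl⟩
      exact (hv i).1
    · intro w hw
      have ha : IsAtom (Φ ⟨{w}, hw⟩) := (OrderIso.isAtom_iff _ _).2 (isAtom_singleton hw)
      have hc := (isCoatom_iff_mem_facets _).1
        (isAtom_dual_iff_isCoatom.1 ha : IsCoatom (OrderDual.ofDual (Φ ⟨{w}, hw⟩)))
      rw [← hF.2] at hc
      obtain ⟨i, hi⟩ := hc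
      obtain ⟨h1, h2⟩ := hv i
      rw [hi] at h2
      have h3 : Φ ⟨{v i}, h1⟩ = Φ ⟨{w}, hw⟩ := Subtype.ext h2
      exact ⟨i, Set.singleton_injective (congrArg Subtype.val (Φ.injective h3))⟩

theorem shelling_dictionary (hn : 0 < n) {P C : Set (Euc n)} (Φ : Face C ≃o (Face P)ᵒᵈ)
    {F : Fin (2 * n) → Set (Euc n)} {v : Fin (2 * n) → Euc n} (hP : IsPolytope P)
    (hC : IsCrosspolytope C) (hF : IsFacetOrdering P F) (hv : IsVertexOrdering C v)
    (hΦ : ∀ i, ∃ h : IsExposed ℝ C {v i}, (OrderDual.ofDual (Φ ⟨{v i}, h⟩)).val = F i) :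
    (IsShelling n P (2 * n) F ↔ IsGoodPairSequence n (pairSequence C v)) ∧
      (IsLineShelling P F ↔ IsLPOrdering C v) ∧
      (IsLPOrdering C v ↔ IsGoodPairSequence n (pairSequence C v)) := by
  obtain ⟨star, hinv, hs, h⟩ := hC.exists_crossFaces hv
  rw [h.isGoodPairSequence_iff hinv hs, h.isLPOrdering_iff hinv hs hn]
  refine ⟨(h.cubeFaces hP Φ hΦ).isShelling_iff hinv hs hn hF.1, ?_, Iff.rfl⟩
  rw [← h.isLPOrdering_iff hinv hs hn]
  exact ⟨isLPOrdering_of_isLineShelling Φ hΦ, h.isLineShelling_of_isLPOrdering hinv hs hn Φ hΦ⟩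

end Duality

end CubeShelling

open CubeShelling

theorem mainTheorem3 (n : ℕ) (hn : 0 < n) :
    -- an ordering of the facets of the `n`-cube is a shelling iff it is a line shelling
    (∀ (P : Set (Euc n)) (F : Fin (2 * n) → Set (Euc n)),
      IsCube P → IsFacetOrdering P F →
        (IsShelling n P (2 * n) F ↔ IsLineShelling P F)) ∧
    -- the dictionary between facets of the cube and vertices of the crosspolytope
    (∀ (P C : Set (Euc n)) (Φ : Face C ≃o (Face P)ᵒᵈ)
      (F : Fin (2 * n) → Set (Euc n)) (v : Fin (2 * n) → Euc n),
      IsCube P → IsCrosspolytope C → IsFacetOrdering P F → IsVertexOrdering C v →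
      (∀ i, ∃ h : IsExposed ℝ C {v i},
        (OrderDual.ofDual (Φ ⟨{v i}, h⟩)).val = F i) →
        (IsShelling n P (2 * n) F ↔ IsGoodPairSequence n (pairSequence C v)) ∧
        (IsLineShelling P F ↔ IsLPOrdering C v)) ∧
    -- line shellings of the polar and orderings of vertices by linear functionals
    (∀ P : Set (Euc n), IsPolytope P → (0 : Euc n) ∈ interior P →
      Set.BijOn (dualFacet P) (vertices P) (facets (polarBody P)) ∧
      ∀ (f : Euc n) (m : ℕ) (v : Fin m → Euc n), IsVertexOrdering P v →
        (((∀ i, inner ℝ f (v i) ≠ 0) ∧ ∀ i j, i < j → inner ℝ f (v i) < inner ℝ f (v j)) ↔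
          IsLineShellingAlong (polarBody P) 0 (-f) (fun i => dualFacet P (v i)))) := by
  refine ⟨fun P F hP hF => ?_, fun P C Φ F v hP hC hF hv hΦ => ?_, fun P hP h0 => ?_⟩
  · obtain ⟨hPp, ⟨e⟩⟩ := hP
    obtain ⟨Ψ⟩ := exists_stdCube_duality hn
    have hC : IsCrosspolytope (stdCrosspolytope n) :=
      ⟨(crossFaces_std n).isPolytope, ⟨OrderIso.refl _⟩⟩
    obtain ⟨v, hv, hvF⟩ := exists_dual_vertexOrdering hC.1 (Ψ.trans e.symm.dual) hF
    obtain ⟨h1, h2, h3⟩ := shelling_dictionary hn _ hPp hC hF hv hvF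
    exact h1.trans (h3.symm.trans h2.symm)
  · obtain ⟨h1, h2, -⟩ := shelling_dictionary hn Φ hP.1 hC hF hv hΦ
    exact ⟨h1, h2⟩
  · exact ⟨bijOn_dualFacet hP h0, fun f m v hv => isLineShellingAlong_polarBody_iff hP h0 f hv⟩
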